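/- Let $(\Omega,\mathcal B)$ be a measurable space, $F_0$ a probability measure on it, $c_0>0$ a real number, $\mathbb T$ a finite index set, $c_t\in\{0,1,2,\dots\}$ and $\partial_t\subset\mathbb T$ for $t\in\mathbb T$. A random probability measure $F$ is a Dirichlet process $\mathcal{DP}(c,F_0)$ if $(F(B_1),\dots,F(B_K))\sim\mathrm{Dir}(cF_0(B_1),\dots,cF_0(B_K))$ for every finite measurable partition $(B_1,\dots,B_K)$ of $\Omega$ (coordinates with zero parameter being $0$ almost surely). A random finite measure $N$ is a multinomial process $\mathcal{MP}(c,G)$, $c\in\{0,1,2,\dots\}$, if $(N(B_1),\dots,N(B_K))\sim\mathrm{Mul}(c;G(B_1),\dots,G(B_K))$ for every such partition. Let $G$, $\mathbf N=(N_t)_{t\in\mathbb T}$ and $\mathbf F=(F_t)_{t\in\mathbb T}$ be random measures on $\Omega$ such that $$G\sim\mathcal{DP}(c_0,F_0),\qquad N_t\mid G\overset{\mathrm{ind}}{\sim}\mathcal{MP}(c_t,G),\qquad F_t\mid\mathbf N\overset{\mathrm{ind}}{\sim}\mathcal{DP}\Big(c_0+\sum_{j\in\partial_t}c_j,\ \frac{c_0F_0+\sum_{j\in\partial_t}N_j}{c_0+\sum_{j\in\partial_t}c_j}\Big),\qquad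 t\in\mathbb T.$$ Then: (i) For every $t\in\mathbb T$, the marginal distribution of $F_t$ is $\mathcal{DP}(c_0,F_0)$. (ii) For all $t\neq t'$ in $\mathbb T$ and every measurable $B$ with $0<F_0(B)<1$, the random variables $F_t(B),F_{t'}(B)$ are square integrable with positive variance, and $$\mathrm{Corr}\{F_t(B),F_{t'}(B)\}=\frac{c_0\sum_{j\in\partial_t\cap\partial_{t'}}c_j+\big(\sum_{j\in\partial_t}c_j\big)\big(\sum_{j\in\partial_{t'}}c_j\big)}{\big(c_0+\sum_{j\in\partial_t}c_j\big)\big(c_0+\sum_{j\in\partial_{t'}}c_j\big)}.$$ For all $t\neq t'$ in $\mathbb T$ and disjoint measurable $B_i,B_k$ with $0<F_0(B_i)<1$ and $0<F_0(B_k)<1$, $$\mathrm{Corr}\{F_t(B_i),F_{t'}(B_k)\}=-\sqrt{\frac{F_0(B_i)F_0(B_k)}{\{1-F_0(B_i)\}\{1-F_0(B_k)\}}}\ \mathrm{Corr}\{F_t(B_i),F_{t'}(B_i)\}.$$ (iii) If $c_t=0$ for all $t\in\mathbb T$, then the random measures $F_t$, $t\in\mathbb T$, are independent. -/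

import Mathlib

open MeasureTheory ProbabilityTheory

noncomputable section

namespace LatentDDP

/-- The gamma law with shape `a` and rate `1`; shape `0` is the point mass at `0`. -/
def gammaLaw (a : ℝ) : Measure ℝ :=
  if 0 < a then gammaMeasure a 1 else Measure.dirac 0

/-- The Dirichlet distribution `Dir(a₁, …, a_K)`, as the law of the normalised vector
`(Z₁, …, Z_K) / ∑ Z_j` for independent `Z_k ~ Gamma(a_k, 1)`. Zero parameters are allowed (not all
of them), the corresponding coordinates being `0` almost surely. -/
def dirichletMeasure {K : ℕ} (a : Fin K → ℝ) : Measure (Fin K → ℝ) :=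
  (Measure.pi fun k => gammaLaw (a k)).map fun z k => z k / ∑ j, z j

/-- The multinomial distribution `Mul(n; p₁, …, p_K)`, as a law on `ℝ^K`: the vector
`(x₁, …, x_K)` of natural numbers with `∑ x_k = n` has mass
`n! / (x₁! ⋯ x_K!) * p₁ ^ x₁ ⋯ p_K ^ x_K`. -/
def multinomialMeasure {K : ℕ} (n : ℕ) (p : Fin K → ℝ) : Measure (Fin K → ℝ) :=
  ∑ x ∈ Finset.piAntidiag (Finset.univ : Finset (Fin K)) n,
    ENNReal.ofReal ((Nat.multinomial Finset.univ x : ℝ) * ∏ k, p k ^ x k) •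
      Measure.dirac (fun k => (x k : ℝ))

/-- `B₁, …, B_K` is a finite measurable partition of the space (empty cells are allowed). -/
structure IsMeasurablePartition {X : Type*} [MeasurableSpace X] {K : ℕ} (B : Fin K → Set X) :
    Prop where
  measurableSet : ∀ k, MeasurableSet (B k)
  disjoint : Pairwise fun i j => Disjoint (B i) (B j)
  iUnion_eq : ⋃ k, B k = Set.univ

/-- The vector of the masses that a measure gives to `B₁, …, B_K`. -/
def massVector {X : Type*} [MeasurableSpace X] {K : ℕ} (B : Fin K → Set X) (μ : Measure X) :
    Fin K → ℝ :=
  fun k => μ.real (B k)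

/-- `F ~ DP(c, F₀)`: the random probability measure `F` is a Dirichlet process with precision `c`
and centring measure `F₀`. -/
structure IsDirichletProcess {Ω X : Type*} [MeasurableSpace Ω] [MeasurableSpace X]
    (c : ℝ) (F₀ : Measure X) (F : Ω → Measure X) (P : Measure Ω) : Prop where
  measurable : Measurable F
  isProbabilityMeasure : ∀ᵐ ω ∂P, IsProbabilityMeasure (F ω)
  hasLaw : ∀ (K : ℕ) (B : Fin K → Set X), IsMeasurablePartition B →
    HasLaw (fun ω => massVector B (F ω)) (dirichletMeasure fun k => c * F₀.real (B k)) P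

/-- Given the σ-algebra `m`, the random variable `V` has the conditional law `κ` (which depends on
`ω`): `P(V ∈ A | m) = κ(A)` almost surely for every measurable `A`. -/
def HasCondLaw {Ω 𝒱 : Type*} [MeasurableSpace 𝒱] (m : MeasurableSpace Ω) {mΩ : MeasurableSpace Ω}
    (V : Ω → 𝒱) (κ : Ω → Measure 𝒱) (P : Measure Ω) : Prop :=
  ∀ A : Set 𝒱, MeasurableSet A → P⟦V ⁻¹' A | m⟧ =ᵐ[P] fun ω => (κ ω).real A

/-- The finite family `V` is conditionally independent given the σ-algebra `m`. (Taking some of the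
`A t` to be the whole space gives the product formula for all subfamilies.) -/
def CondIndepFamily {Ω 𝒱 T : Type*} [Fintype T] [MeasurableSpace 𝒱] (m : MeasurableSpace Ω)
    {mΩ : MeasurableSpace Ω} (V : T → Ω → 𝒱) (P : Measure Ω) : Prop :=
  ∀ A : T → Set 𝒱, (∀ t, MeasurableSet (A t)) →
    P⟦⋂ t, V t ⁻¹' A t | m⟧ =ᵐ[P] fun ω => ∏ t, (P⟦V t ⁻¹' A t | m⟧) ω

/-- Given `m`, the random measure `N` is a multinomial process `MP(c, G)`. -/
def CondMultinomialProcess {Ω X : Type*} [MeasurableSpace X] (m : MeasurableSpace Ω)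
    {mΩ : MeasurableSpace Ω} (c : ℕ) (G N : Ω → Measure X) (P : Measure Ω) : Prop :=
  ∀ (K : ℕ) (B : Fin K → Set X), IsMeasurablePartition B →
    HasCondLaw m (fun ω => massVector B (N ω))
      (fun ω => multinomialMeasure c (massVector B (G ω))) P

/-- Given `m`, the random measure `F` is a Dirichlet process `DP(c, H)`, where the centring measure
`H` is random. -/
def CondDirichletProcess {Ω X : Type*} [MeasurableSpace X] (m : MeasurableSpace Ω)
    {mΩ : MeasurableSpace Ω} (c : ℝ) (H F : Ω → Measure X) (P : Measure Ω) : Prop :=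
  ∀ (K : ℕ) (B : Fin K → Set X), IsMeasurablePartition B →
    HasCondLaw m (fun ω => massVector B (F ω))
      (fun ω => dirichletMeasure fun k => c * (H ω).real (B k)) P

/-- The precision `c₀ + ∑_{j ∈ s} c_j` of the third level, for the neighbourhood `s`. -/
def updatedPrecision {T : Type*} (c₀ : ℝ) (c : T → ℕ) (s : Finset T) : ℝ :=
  c₀ + ∑ j ∈ s, (c j : ℝ)

/-- The centring measure `(c₀ F₀ + ∑_{j ∈ s} N_j) / (c₀ + ∑_{j ∈ s} c_j)` of the third level. -/
def updatedCentre {T X : Type*} [MeasurableSpace X] (c₀ : ℝ) (c : T → ℕ) (F₀ : Measure X)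
    (s : Finset T) (N : T → Measure X) : Measure X :=
  (ENNReal.ofReal (updatedPrecision c₀ c s))⁻¹ • (ENNReal.ofReal c₀ • F₀ + ∑ j ∈ s, N j)

/-- The three-level hierarchical model: `G ~ DP(c₀, F₀)`; given `G`, the `N t` are independent with
`N t ~ MP(c t, G)`; given `(N t)_t`, the `F t` are independent with
`F t ~ DP(c₀ + ∑_{j ∈ nb t} c j, (c₀ F₀ + ∑_{j ∈ nb t} N j) / (c₀ + ∑_{j ∈ nb t} c j))`. -/
structure IsDDP {Ω X T : Type*} [MeasurableSpace Ω] [MeasurableSpace X] [Fintype T]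
    (c₀ : ℝ) (c : T → ℕ) (nb : T → Finset T) (F₀ : Measure X)
    (G : Ω → Measure X) (N F : T → Ω → Measure X) (P : Measure Ω) : Prop where
  level_one : IsDirichletProcess c₀ F₀ G P
  measurable_N : ∀ t, Measurable (N t)
  isFiniteMeasure_N : ∀ t, ∀ᵐ ω ∂P, IsFiniteMeasure (N t ω)
  condIndep_N : CondIndepFamily (MeasurableSpace.comap G inferInstance) N P
  level_two : ∀ t, CondMultinomialProcess (MeasurableSpace.comap G inferInstance) (c t) G (N t) P
  measurable_F : ∀ t, Measurable (F t)
  isProbabilityMeasure_F : ∀ t, ∀ᵐ ω ∂P, IsProbabilityMeasure (F t ω)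
  condIndep_F :
    CondIndepFamily (MeasurableSpace.comap (fun ω t => N t ω) inferInstance) F P
  level_three : ∀ t,
    CondDirichletProcess (MeasurableSpace.comap (fun ω t => N t ω) inferInstance)
      (updatedPrecision c₀ c (nb t))
      (fun ω => updatedCentre c₀ c F₀ (nb t) fun j => N j ω) (F t) P

/-- Pearson correlation `Cov(U, V) / (√Var(U) √Var(V))`. -/
def corr {Ω : Type*} [MeasurableSpace Ω] (U V : Ω → ℝ) (P : Measure Ω) : ℝ :=
  cov[U, V; P] / (√(Var[U; P]) * √(Var[V; P]))

end LatentDDP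

end

/-!
On a fixed partition the model is finite-dimensional: Dirichlet weights `p`, multinomial counts
given `p`, and Dirichlet vectors given the counts, so that everything reduces to conjugacy and to
moments of bounded vectors.

**Conjugacy.** `Dir(a)` is the law of the normalised vector `z / ∑ z` of independent gamma
variables. The basic identity is that `p_k` times `Dir(a)` is `a_k / ∑ a` times `Dir(a + e_k)`
(`dirichletMeasure_withDensity_apply`). For gamma vectors the analogue is immediate from the
densities, and the passage to normalised vectors needs only that the total mass `∑ z` and the event
`z / ∑ z ∈ A` are uncorrelated (`gammaPi_setLIntegral_sum`). Instead of a change of variables, this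
uses exponential tilting: tilting by `exp (t * ∑ z)` rescales `z`, which leaves `z / ∑ z` unchanged,
so the moment generating function of `∑ z` on the event is known, and its derivative at `0` is the
required mean. Iterating gives that `p ^ y` times `Dir(a)` is a multiple of `Dir(a + y)`.

**Marginals.** The law of `F t` on a partition is a mixture of the laws `Dir(a + ∑ x)` over the
counts `x`, where the probability of `x` is the `Dir(a)`-mean of a product of multinomial masses.
By conjugacy each term is the integral of that product over the event, and the multinomial masses
sum to one (`sum_integral_mul_dirichletMeasure_real`).

**Covariances.** Given the counts, `F t` and `F t'` are independent, so their covariance is that of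
their posterior means, which are affine in the counts (`IsDDP.integral_massVector_mul`). Count
covariances follow from the moments of Dirichlet and multinomial vectors: with `V` the prior
covariance of two cells, those of the `j`-th and `j'`-th counts have covariance
`(c j * c j' + if j = j' then c₀ * c j else 0) * V` (`MixedCounts.covariance_count`). Summing over
the two neighbourhoods gives the correlation.

**Independence.** If every `c t` is `0` the counts vanish, and the conditional laws of the `F t` on
a partition do not depend on the counts, which gives independence on every partition. Finitely many
measurable sets are unions of cells of a common partition, so all finite-dimensional marginals are
independent; these determine the σ-algebra on measures.
-/

namespace LatentDDP

open scoped ENNReal NNReal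

/-! ### Gamma laws -/

instance isProbabilityMeasure_gammaLaw (a : ℝ) : IsProbabilityMeasure (gammaLaw a) := by
  unfold gammaLaw
  split_ifs with h
  · exact isProbabilityMeasure_gammaMeasure h one_pos
  · infer_instance

lemma gammaLaw_of_pos {a : ℝ} (ha : 0 < a) : gammaLaw a = gammaMeasure a 1 := if_pos ha

lemma gammaLaw_zero : gammaLaw 0 = Measure.dirac 0 := if_neg (lt_irrefl 0)

lemma measurable_gammaPDF (a r : ℝ) : Measurable (gammaPDF a r) :=
  (measurable_gammaPDFReal a r).ennreal_ofReal

lemma gammaLaw_nonneg (a : ℝ) : ∀ᵐ z ∂gammaLaw a, 0 ≤ z := by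
  unfold gammaLaw
  split_ifs with h
  · rw [gammaMeasure, ae_withDensity_iff (measurable_gammaPDF a 1)]
    refine ae_of_all _ fun z hz => ?_
    by_contra hneg
    exact hz (gammaPDF_of_neg (not_le.1 hneg))
  · exact (ae_dirac_iff (p := fun z : ℝ => 0 ≤ z) measurableSet_Ici).2 le_rfl

lemma gammaLaw_pos {a : ℝ} (ha : 0 < a) : ∀ᵐ z ∂gammaLaw a, 0 < z := by
  have h0 : ∀ᵐ z ∂gammaLaw a, z ≠ 0 := by
    rw [gammaLaw_of_pos ha, gammaMeasure]
    refine (withDensity_absolutelyContinuous _ _).ae_le ?_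
    exact Measure.ae_ne volume 0
  filter_upwards [h0, gammaLaw_nonneg a] with z h1 h2
  exact lt_of_le_of_ne h2 h1.symm

/-- Size-biasing a gamma law raises its shape by one. -/
lemma gammaLaw_withDensity_id {a : ℝ} (ha : 0 ≤ a) :
    (gammaLaw a).withDensity (fun z => ENNReal.ofReal z) = ENNReal.ofReal a • gammaLaw (a + 1) := by
  rcases ha.eq_or_lt with rfl | ha
  · rw [gammaLaw_zero]
    ext s hs
    classical
    rw [withDensity_apply _ hs, setLIntegral_dirac' ENNReal.measurable_ofReal hs]
    simp
  · rw [gammaLaw_of_pos ha, gammaLaw_of_pos (by positivity), gammaMeasure, gammaMeasure,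
      ← withDensity_mul _ (measurable_gammaPDF a 1) ENNReal.measurable_ofReal,
      ← withDensity_smul _ (measurable_gammaPDF _ 1)]
    congr 1
    ext z
    rcases lt_or_ge z 0 with hz | hz
    · simp [gammaPDF_of_neg hz]
    · simp only [Pi.mul_apply, Pi.smul_apply, smul_eq_mul, gammaPDF_of_nonneg hz]
      rcases hz.eq_or_lt with rfl | hz'
      · simp [Real.zero_rpow ha.ne']
      · rw [← ENNReal.ofReal_mul (by positivity), ← ENNReal.ofReal_mul ha.le]
        congr 1
        rw [Real.Gamma_add_one ha.ne', add_sub_cancel_right, Real.rpow_sub_one hz'.ne']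
        have := Real.Gamma_pos_of_pos ha
        simp only [Real.one_rpow]
        field_simp

/-- Exponentially tilting a gamma law rescales it. -/
lemma gammaLaw_withDensity_exp {a t : ℝ} (ha : 0 ≤ a) (ht : t < 1) :
    (gammaLaw a).withDensity (fun z => ENNReal.ofReal (Real.exp (t * z))) =
      ENNReal.ofReal ((1 - t) ^ (-a)) • (gammaLaw a).map (fun z => (1 - t)⁻¹ * z) := by
  have h1 : 0 < 1 - t := by linarith
  have hexp : Measurable fun z : ℝ => ENNReal.ofReal (Real.exp (t * z)) := by fun_prop
  rcases ha.eq_or_lt with rfl | ha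
  · rw [gammaLaw_zero]
    ext s hs
    classical
    rw [withDensity_apply _ hs, setLIntegral_dirac' hexp hs]
    rw [Measure.map_dirac' (by fun_prop)]
    simp [Set.indicator, Measure.dirac_apply' _ hs]
  · rw [gammaLaw_of_pos ha, gammaMeasure, ← withDensity_mul _ (measurable_gammaPDF a 1) hexp]
    ext s hs
    have hm : Measurable fun z : ℝ => (1 - t)⁻¹ * z := by fun_prop
    rw [Measure.smul_apply, Measure.map_apply hm hs, withDensity_apply _ hs,
      withDensity_apply _ (hm hs), ← lintegral_indicator hs, ← lintegral_indicator (hm hs)]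
    have hr : (1 - t)⁻¹ ≠ 0 := inv_ne_zero h1.ne'
    nth_rw 1 [← Real.smul_map_volume_mul_left hr]
    rw [lintegral_smul_measure, lintegral_map _ hm]
    · rw [smul_eq_mul, smul_eq_mul, ← lintegral_const_mul, ← lintegral_const_mul]
      · congr 1
        ext z
        by_cases hz : (1 - t)⁻¹ * z ∈ s
        · have hz' : z ∈ (fun z : ℝ => (1 - t)⁻¹ * z) ⁻¹' s := hz
          rw [Set.indicator_of_mem hz, Set.indicator_of_mem hz', Pi.mul_apply]
          rcases lt_or_ge z 0 with h0 | h0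
          · rw [gammaPDF_of_neg h0, gammaPDF_of_neg]
            · simp
            · exact mul_neg_of_pos_of_neg (inv_pos.2 h1) h0
          · have h0' : 0 ≤ (1 - t)⁻¹ * z := by positivity
            have hG := Real.Gamma_pos_of_pos ha
            rw [gammaPDF_of_nonneg h0, gammaPDF_of_nonneg h0', abs_of_pos (inv_pos.2 h1),
              ← ENNReal.ofReal_mul (by positivity), ← ENNReal.ofReal_mul (by positivity),
              ← ENNReal.ofReal_mul (by positivity)]
            congr 1
            rw [Real.mul_rpow (inv_pos.2 h1).le h0, Real.inv_rpow h1.le, Real.rpow_neg h1.le,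
              Real.rpow_sub_one h1.ne', show -(1 * z) = -(1 * ((1 - t)⁻¹ * z)) +
                t * ((1 - t)⁻¹ * z) by field_simp; ring, Real.exp_add]
            have := Real.rpow_pos_of_pos h1 a
            field_simp
        · have hz' : z ∉ (fun z : ℝ => (1 - t)⁻¹ * z) ⁻¹' s := hz
          rw [Set.indicator_of_notMem hz, Set.indicator_of_notMem hz']
          simp
      · exact (measurable_gammaPDF a 1).indicator (hm hs)
      · exact (((measurable_gammaPDF a 1).mul hexp).indicator hs).comp hm
    · exact ((measurable_gammaPDF a 1).mul hexp).indicator hs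

/-! ### Dirichlet distributions -/

/-- Densities that factor over the coordinates pass through product measures. -/
lemma pi_withDensity_prod {ι : Type*} [Fintype ι] {μ ν : ι → Measure ℝ}
    [∀ i, IsProbabilityMeasure (μ i)] [∀ i, IsProbabilityMeasure (ν i)] {f : ι → ℝ → ℝ≥0∞}
    (hf : ∀ i, Measurable (f i)) {c : ι → ℝ≥0} (h : ∀ i, (μ i).withDensity (f i) = c i • ν i) :
    (Measure.pi μ).withDensity (fun z => ∏ i, f i (z i)) = (∏ i, c i) • Measure.pi ν := by
  classical
  have h1 : Measure.pi (fun i => c i • ν i) = (∏ i, c i) • Measure.pi ν := by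
    refine Measure.pi_eq fun s hs => ?_
    rw [Measure.smul_apply, Measure.pi_pi, ENNReal.smul_def, smul_eq_mul,
      ENNReal.ofNNReal_finsetProd, ← Finset.prod_mul_distrib]
    rfl
  rw [← h1]
  refine (Measure.pi_eq fun s hs => ?_).symm
  rw [withDensity_apply _ (MeasurableSet.univ_pi hs),
    ← lintegral_indicator (MeasurableSet.univ_pi hs)]
  have hind : (Set.univ.pi s).indicator (fun z : ι → ℝ => ∏ i, f i (z i)) =
      fun z => ∏ i, (s i).indicator (f i) (z i) := by
    ext z
    by_cases hz : z ∈ Set.univ.pi s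
    · rw [Set.indicator_of_mem hz]
      refine Finset.prod_congr rfl fun i _ => ?_
      rw [Set.indicator_of_mem (hz i (Set.mem_univ i))]
    · rw [Set.indicator_of_notMem hz]
      simp only [Set.mem_univ_pi, not_forall] at hz
      obtain ⟨i, hi⟩ := hz
      rw [Finset.prod_eq_zero (Finset.mem_univ i)]
      rw [Set.indicator_of_notMem hi]
  have hm : ∀ i, Measurable ((s i).indicator (f i)) := fun i => (hf i).indicator (hs i)
  rw [hind, lintegral_prod_eq_prod_lintegral_of_indepFun Finset.univ
    (fun i (z : ι → ℝ) => (s i).indicator (f i) (z i))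
    (iIndepFun_pi fun i => (hm i).aemeasurable)
    (fun i => (hm i).comp (measurable_pi_apply i))]
  refine Finset.prod_congr rfl fun i _ => ?_
  rw [(measurePreserving_eval μ i).lintegral_comp (hm i), lintegral_indicator (hs i),
    ← withDensity_apply _ (hs i), h i]

section Dirichlet

variable {K : ℕ}

/-- The vector rescaled to have total mass one. -/
noncomputable def normalise (z : Fin K → ℝ) : Fin K → ℝ := fun k => z k / ∑ j, z j

lemma measurable_normalise : Measurable (normalise (K := K)) := by
  unfold normalise
  fun_prop

lemma normalise_const_mul {r : ℝ} (hr : r ≠ 0) (z : Fin K → ℝ) :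
    normalise (fun k => r * z k) = normalise z := by
  ext k
  simp only [normalise, ← Finset.mul_sum]
  rw [mul_div_mul_left _ _ hr]

/-- The law of independent gamma variables with shapes `a`. -/
noncomputable def gammaPi (a : Fin K → ℝ) : Measure (Fin K → ℝ) :=
  Measure.pi fun k => gammaLaw (a k)

instance isProbabilityMeasure_gammaPi (a : Fin K → ℝ) : IsProbabilityMeasure (gammaPi a) := by
  unfold gammaPi; infer_instance

lemma dirichletMeasure_eq_map (a : Fin K → ℝ) :
    dirichletMeasure a = (gammaPi a).map normalise := rfl

instance isProbabilityMeasure_dirichletMeasure (a : Fin K → ℝ) :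
    IsProbabilityMeasure (dirichletMeasure a) := by
  rw [dirichletMeasure_eq_map]
  exact Measure.isProbabilityMeasure_map measurable_normalise.aemeasurable

lemma gammaPi_nonneg (a : Fin K → ℝ) : ∀ᵐ z ∂gammaPi a, ∀ k, 0 ≤ z k :=
  ae_all_iff.2 fun k => (Measure.quasiMeasurePreserving_eval (fun k => gammaLaw (a k)) k).ae
    (gammaLaw_nonneg (a k))

lemma gammaPi_sum_pos {a : Fin K → ℝ} (ha : 0 < ∑ k, a k) :
    ∀ᵐ z ∂gammaPi a, 0 < ∑ k, z k := by
  obtain ⟨k, -, hk⟩ : ∃ k ∈ Finset.univ, 0 < a k := by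
    by_contra! hneg
    exact ha.not_ge (Finset.sum_nonpos hneg)
  filter_upwards [gammaPi_nonneg a, (Measure.quasiMeasurePreserving_eval
    (fun k => gammaLaw (a k)) k).ae (gammaLaw_pos hk)] with z h0 h1
  exact Finset.sum_pos' (fun i _ => h0 i) ⟨k, Finset.mem_univ k, h1⟩

lemma dirichletMeasure_nonneg (a : Fin K → ℝ) : ∀ᵐ p ∂dirichletMeasure a, ∀ k, 0 ≤ p k := by
  have hm : MeasurableSet {p : Fin K → ℝ | ∀ k, 0 ≤ p k} :=
    by measurability
  rw [dirichletMeasure_eq_map, ae_map_iff measurable_normalise.aemeasurable hm]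
  filter_upwards [gammaPi_nonneg a] with z hz k
  exact div_nonneg (hz k) (Finset.sum_nonneg fun i _ => hz i)

lemma dirichletMeasure_sum_eq_one {a : Fin K → ℝ} (ha : 0 < ∑ k, a k) :
    ∀ᵐ p ∂dirichletMeasure a, ∑ k, p k = 1 := by
  have hm : MeasurableSet {p : Fin K → ℝ | ∑ k, p k = 1} :=
    measurableSet_eq_fun (by fun_prop) measurable_const
  rw [dirichletMeasure_eq_map, ae_map_iff measurable_normalise.aemeasurable hm]
  filter_upwards [gammaPi_sum_pos ha] with z hz
  simp only [normalise, ← Finset.sum_div]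
  exact div_self hz.ne'

lemma dirichletMeasure_le_one {a : Fin K → ℝ} (ha : 0 < ∑ k, a k) :
    ∀ᵐ p ∂dirichletMeasure a, ∀ k, p k ≤ 1 := by
  filter_upwards [dirichletMeasure_nonneg a, dirichletMeasure_sum_eq_one ha] with p h0 h1 k
  rw [← h1]
  exact Finset.single_le_sum (fun i _ => h0 i) (Finset.mem_univ k)

/-- Size-biasing independent gamma variables by their `k`-th coordinate. -/
lemma gammaPi_withDensity_apply {a : Fin K → ℝ} (ha : ∀ k, 0 ≤ a k) (k : Fin K) :
    (gammaPi a).withDensity (fun z => ENNReal.ofReal (z k)) =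
      ENNReal.ofReal (a k) • gammaPi (a + Pi.single k 1) := by
  have h := pi_withDensity_prod (μ := fun i => gammaLaw (a i))
    (ν := fun i => gammaLaw ((a + Pi.single k 1 : Fin K → ℝ) i))
    (f := fun i => if i = k then ENNReal.ofReal else 1)
    (c := fun i => if i = k then (a i).toNNReal else 1)
    (fun i => by split_ifs; exacts [ENNReal.measurable_ofReal, measurable_const]) fun i => ?_
  · simp only [Finset.prod_ite_eq', Finset.mem_univ, if_true, ite_apply,
      Pi.one_apply] at h
    exact h
  · by_cases hi : i = k
    · subst hi
      simp only [if_true, Pi.add_apply, Pi.single_eq_same]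
      exact gammaLaw_withDensity_id (ha i)
    · simp [hi]

/-- Exponentially tilting independent gamma variables by their sum rescales the vector. -/
lemma gammaPi_withDensity_exp {a : Fin K → ℝ} (ha : ∀ k, 0 ≤ a k) {t : ℝ} (ht : t < 1) :
    (gammaPi a).withDensity (fun z => ENNReal.ofReal (Real.exp (t * ∑ k, z k))) =
      ENNReal.ofReal ((1 - t) ^ (-∑ k, a k)) •
        (gammaPi a).map (fun z k => (1 - t)⁻¹ * z k) := by
  have h1 : 0 < 1 - t := by linarith
  have hm : Measurable fun z : ℝ => (1 - t)⁻¹ * z := by fun_prop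
  have hpr : ∀ i, IsProbabilityMeasure ((gammaLaw (a i)).map (fun z => (1 - t)⁻¹ * z)) :=
    fun i => Measure.isProbabilityMeasure_map hm.aemeasurable
  have h := pi_withDensity_prod (μ := fun i => gammaLaw (a i))
    (ν := fun i => (gammaLaw (a i)).map (fun z => (1 - t)⁻¹ * z))
    (f := fun _ z => ENNReal.ofReal (Real.exp (t * z)))
    (c := fun i => ((1 - t) ^ (-a i)).toNNReal)
    (fun i => by fun_prop) fun i => gammaLaw_withDensity_exp (ha i) ht
  rw [← Measure.pi_map_pi (fun i => hm.aemeasurable)] at h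
  unfold gammaPi
  convert h using 1
  · congr 1
    ext z
    rw [← ENNReal.ofReal_prod_of_nonneg fun _ _ => (Real.exp_pos _).le, ← Real.exp_sum,
      Finset.mul_sum]
  · rw [← Real.toNNReal_prod_of_nonneg (fun i _ => Real.rpow_nonneg h1.le _),
      ← Real.rpow_sum_of_pos h1, Finset.sum_neg_distrib]
    rfl

lemma measurable_sum_coord : Measurable fun z : Fin K → ℝ => ∑ k, z k := by fun_prop

/-- The total mass of independent gamma variables is independent of the normalised vector; this is
the consequence for the first moment of the total mass. It is obtained by differentiating the
moment generating function on the event `normalise z ∈ A`, which the tilting formula computes. -/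
lemma gammaPi_setLIntegral_sum {a : Fin K → ℝ} (ha : ∀ k, 0 ≤ a k) {A : Set (Fin K → ℝ)}
    (hA : MeasurableSet A) :
    ∫⁻ z in normalise ⁻¹' A, ENNReal.ofReal (∑ k, z k) ∂gammaPi a =
      ENNReal.ofReal (∑ k, a k) * dirichletMeasure a A := by
  set S : (Fin K → ℝ) → ℝ := fun z => ∑ k, z k with hS
  have hSm : Measurable S := measurable_sum_coord
  have hA' := measurable_normalise hA
  set ν := (gammaPi a).restrict (normalise ⁻¹' A) with hν
  have hl : ∀ t < 1, ∫⁻ z, ENNReal.ofReal (Real.exp (t * S z)) ∂ν =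
      ENNReal.ofReal ((1 - t) ^ (-∑ k, a k)) * dirichletMeasure a A := by
    intro t ht
    have hm : Measurable fun (z : Fin K → ℝ) k => (1 - t)⁻¹ * z k := by fun_prop
    rw [hν, ← withDensity_apply _ hA', gammaPi_withDensity_exp ha ht, Measure.smul_apply,
      Measure.map_apply hm hA', smul_eq_mul, dirichletMeasure_eq_map,
      Measure.map_apply measurable_normalise hA]
    congr 2
    ext z
    simp only [Set.mem_preimage, normalise_const_mul (inv_ne_zero (sub_pos.2 ht).ne')]
  have hint : ∀ t < 1, Integrable (fun z => Real.exp (t * S z)) ν := by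
    intro t ht
    refine ⟨by fun_prop, ?_⟩
    rw [hasFiniteIntegral_iff_ofReal (ae_of_all _ fun z => (Real.exp_pos _).le), hl t ht]
    exact ENNReal.mul_lt_top ENNReal.ofReal_lt_top (measure_lt_top _ _)
  have hmgf : ∀ t < 1, mgf S ν t = (1 - t) ^ (-∑ k, a k) * (dirichletMeasure a).real A := by
    intro t ht
    rw [mgf, integral_eq_lintegral_of_nonneg_ae (ae_of_all _ fun z => (Real.exp_pos _).le)
      (hint t ht).1, hl t ht, ENNReal.toReal_mul, ENNReal.toReal_ofReal, measureReal_def]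
    exact Real.rpow_nonneg (by linarith) _
  have h0 : (0 : ℝ) ∈ interior (integrableExpSet S ν) :=
    mem_interior.2 ⟨Set.Iio 1, fun t ht => hint t ht, isOpen_Iio, by simp⟩
  have hd : HasDerivAt (fun t : ℝ => (1 - t) ^ (-∑ k, a k) * (dirichletMeasure a).real A)
      ((∑ k, a k) * (dirichletMeasure a).real A) 0 := by
    have := ((hasDerivAt_id (0 : ℝ)).const_sub 1).rpow_const (p := -∑ k, a k)
      (Or.inl (by simp))
    refine (this.mul_const ((dirichletMeasure a).real A)).congr_deriv ?_
    simp
  have hev : mgf S ν =ᶠ[nhds 0]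
      fun t : ℝ => (1 - t) ^ (-∑ k, a k) * (dirichletMeasure a).real A := by
    filter_upwards [Iio_mem_nhds (zero_lt_one' ℝ)] with t ht using hmgf t ht
  have hE : ν[S] = (∑ k, a k) * (dirichletMeasure a).real A := by
    rw [← deriv_mgf_zero h0, hev.deriv_eq, hd.deriv]
  have hSi : Integrable S ν := by
    simpa using integrable_pow_of_mem_interior_integrableExpSet h0 1
  have hnn : 0 ≤ᵐ[ν] S := by
    refine ae_restrict_of_ae ?_
    filter_upwards [gammaPi_nonneg a] with z hz
    exact Finset.sum_nonneg fun i _ => hz i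
  rw [← ofReal_integral_eq_lintegral_ofReal hSi hnn, hE,
    ENNReal.ofReal_mul (Finset.sum_nonneg fun i _ => ha i), ofReal_measureReal]

/-- Size-biasing a Dirichlet law by its `k`-th coordinate adds one to the `k`-th parameter. -/
lemma dirichletMeasure_withDensity_apply {a : Fin K → ℝ} (ha : ∀ k, 0 ≤ a k)
    (hs : 0 < ∑ k, a k) (k : Fin K) :
    ENNReal.ofReal (∑ i, a i) • (dirichletMeasure a).withDensity (fun p => ENNReal.ofReal (p k)) =
      ENNReal.ofReal (a k) • dirichletMeasure (a + Pi.single k 1) := by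
  have hmap : ((gammaPi a).withDensity fun z => ENNReal.ofReal (∑ i, z i)).map normalise =
      ENNReal.ofReal (∑ i, a i) • dirichletMeasure a := by
    ext A hA
    rw [Measure.map_apply measurable_normalise hA,
      withDensity_apply _ (measurable_normalise hA), gammaPi_setLIntegral_sum ha hA,
      Measure.smul_apply, smul_eq_mul]
  have hSm : Measurable fun z : Fin K → ℝ => ENNReal.ofReal (∑ k, z k) :=
    measurable_sum_coord.ennreal_ofReal
  have hkm : Measurable fun z : Fin K → ℝ => ENNReal.ofReal (z k) := by fun_prop
  ext A hA
  have hA' := measurable_normalise hA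
  have hg : Measurable (A.indicator fun p : Fin K → ℝ => ENNReal.ofReal (p k)) := hkm.indicator hA
  calc (ENNReal.ofReal (∑ i, a i) •
          (dirichletMeasure a).withDensity (fun p => ENNReal.ofReal (p k))) A
      = ∫⁻ p, A.indicator (fun p => ENNReal.ofReal (p k)) p
          ∂(ENNReal.ofReal (∑ i, a i) • dirichletMeasure a) := by
        rw [lintegral_smul_measure, lintegral_indicator hA, Measure.smul_apply,
          withDensity_apply _ hA]
    _ = ∫⁻ z, ENNReal.ofReal (∑ i, z i) *
          A.indicator (fun p => ENNReal.ofReal (p k)) (normalise z) ∂gammaPi a := by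
        rw [← hmap, lintegral_map hg measurable_normalise,
          lintegral_withDensity_eq_lintegral_mul _ hSm
            (g := fun z => A.indicator (fun p : Fin K → ℝ => ENNReal.ofReal (p k)) (normalise z))
            (hg.comp measurable_normalise)]
        rfl
    _ = ∫⁻ z, (normalise ⁻¹' A).indicator (fun z => ENNReal.ofReal (z k)) z ∂gammaPi a := by
        refine lintegral_congr_ae ?_
        filter_upwards [gammaPi_sum_pos hs] with z hz
        by_cases hzA : normalise z ∈ A
        · rw [Set.indicator_of_mem hzA, Set.indicator_of_mem (by exact hzA),
            ← ENNReal.ofReal_mul hz.le, normalise, mul_div_cancel₀ _ hz.ne']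
        · rw [Set.indicator_of_notMem hzA, Set.indicator_of_notMem (by exact hzA), mul_zero]
    _ = (ENNReal.ofReal (a k) • dirichletMeasure (a + Pi.single k 1)) A := by
        rw [lintegral_indicator hA', ← withDensity_apply _ hA', gammaPi_withDensity_apply ha,
          Measure.smul_apply, Measure.smul_apply, dirichletMeasure_eq_map,
          Measure.map_apply measurable_normalise hA]

/-- The size-biasing identity solved for the weighted measure. -/
lemma dirichletMeasure_withDensity_apply' {a : Fin K → ℝ} (ha : ∀ k, 0 ≤ a k)
    (hs : 0 < ∑ k, a k) (k : Fin K) :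
    (dirichletMeasure a).withDensity (fun p => ENNReal.ofReal (p k)) =
      ENNReal.ofReal (a k / ∑ i, a i) • dirichletMeasure (a + Pi.single k 1) := by
  have h := dirichletMeasure_withDensity_apply ha hs k
  have h0 : ENNReal.ofReal (∑ i, a i) ≠ 0 := by simpa using hs
  rw [ENNReal.ofReal_div_of_pos hs, div_eq_mul_inv, mul_comm, mul_smul, ← h, smul_smul,
    ENNReal.inv_mul_cancel h0 ENNReal.ofReal_ne_top, one_smul]

lemma integral_coord_mul_dirichletMeasure {a : Fin K → ℝ} (ha : ∀ k, 0 ≤ a k)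
    (hs : 0 < ∑ k, a k) (k : Fin K) (f : (Fin K → ℝ) → ℝ) :
    ∫ p, p k * f p ∂dirichletMeasure a =
      a k / (∑ i, a i) * ∫ p, f p ∂dirichletMeasure (a + Pi.single k 1) := by
  have h := integral_withDensity_eq_integral_toReal_smul (μ := dirichletMeasure a)
    (f := fun p => ENNReal.ofReal (p k)) (by fun_prop)
    (ae_of_all _ fun _ => ENNReal.ofReal_lt_top) f
  rw [dirichletMeasure_withDensity_apply' ha hs, integral_smul_measure,
    ENNReal.toReal_ofReal (div_nonneg (ha k) hs.le), smul_eq_mul] at h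
  rw [h]
  refine integral_congr_ae ?_
  filter_upwards [dirichletMeasure_nonneg a] with p hp
  rw [ENNReal.toReal_ofReal (hp k), smul_eq_mul]

lemma integral_coord_dirichletMeasure {a : Fin K → ℝ} (ha : ∀ k, 0 ≤ a k)
    (hs : 0 < ∑ k, a k) (k : Fin K) :
    ∫ p, p k ∂dirichletMeasure a = a k / ∑ i, a i := by
  simpa using integral_coord_mul_dirichletMeasure ha hs k (fun _ => 1)

lemma add_single_nonneg {a : Fin K → ℝ} (ha : ∀ k, 0 ≤ a k) (k i : Fin K) :
    0 ≤ (a + Pi.single k 1 : Fin K → ℝ) i := by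
  rcases eq_or_ne i k with rfl | h
  · simpa using add_nonneg (ha i) zero_le_one
  · simpa [h] using ha i

lemma sum_add_single (a : Fin K → ℝ) (k : Fin K) :
    ∑ i, (a + Pi.single k 1 : Fin K → ℝ) i = (∑ i, a i) + 1 := by
  simp [Finset.sum_add_distrib]

lemma integral_coord_mul_coord_dirichletMeasure {a : Fin K → ℝ} (ha : ∀ k, 0 ≤ a k)
    (hs : 0 < ∑ k, a k) (k l : Fin K) :
    ∫ p, p k * p l ∂dirichletMeasure a =
      a k / (∑ i, a i) * ((a l + if k = l then 1 else 0) / ((∑ i, a i) + 1)) := by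
  rw [integral_coord_mul_dirichletMeasure ha hs k (fun p => p l),
    integral_coord_dirichletMeasure (add_single_nonneg ha k) (by rw [sum_add_single]; positivity),
    sum_add_single]
  simp [Pi.single_apply, eq_comm]

/-- Conjugacy of the Dirichlet and multinomial distributions: weighting `Dir(a)` by the likelihood
`p ^ y` gives a multiple of `Dir(a + y)`. -/
lemma exists_dirichletMeasure_withDensity_prod_pow (y : Fin K → ℕ) {a : Fin K → ℝ}
    (ha : ∀ k, 0 ≤ a k) (hs : 0 < ∑ k, a k) :
    ∃ C : ℝ≥0∞, (dirichletMeasure a).withDensity (fun p => ∏ k, ENNReal.ofReal (p k) ^ y k) =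
      C • dirichletMeasure (fun k => a k + y k) := by
  induction h : ∑ k, y k generalizing y with
  | zero =>
    have h0 : y = 0 := by
      ext k
      exact Finset.sum_eq_zero_iff.1 h k (Finset.mem_univ k)
    refine ⟨1, ?_⟩
    subst h0
    simp
  | succ n ih =>
    obtain ⟨k, hk⟩ : ∃ k, 0 < y k := by
      by_contra! hneg
      simp [fun k => Nat.le_zero.1 (hneg k)] at h
    obtain ⟨z, rfl⟩ : ∃ z : Fin K → ℕ, y = z + Pi.single k 1 := by
      refine ⟨y - Pi.single k 1, ?_⟩
      ext i
      rcases eq_or_ne i k with rfl | hi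
      · simp [Nat.sub_add_cancel hk]
      · simp [hi]
    obtain ⟨C, hC⟩ := ih z (by simpa [Finset.sum_add_distrib] using h)
    have hz : ∀ i, 0 ≤ a i + z i := fun i => add_nonneg (ha i) (Nat.cast_nonneg _)
    have hzs : 0 < ∑ i, (a i + (z i : ℝ)) := hs.trans_le
      (Finset.sum_le_sum fun i _ => le_add_of_nonneg_right (Nat.cast_nonneg _))
    have hprod : (fun p : Fin K → ℝ => ∏ i,
        ENNReal.ofReal (p i) ^ (z + Pi.single k 1 : Fin K → ℕ) i) =
        (fun p => ∏ i, ENNReal.ofReal (p i) ^ z i) * fun p => ENNReal.ofReal (p k) := by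
      ext p
      simp only [Pi.add_apply, pow_add, Finset.prod_mul_distrib, Pi.mul_apply]
      congr 1
      rw [Finset.prod_eq_single k]
      · simp
      · intro i _ hi
        simp [hi]
      · simp
    refine ⟨C * ENNReal.ofReal ((a k + z k) / ∑ i, (a i + z i)), ?_⟩
    rw [hprod, withDensity_mul _ (by fun_prop) (by fun_prop), hC, withDensity_smul_measure,
      dirichletMeasure_withDensity_apply' hz hzs, smul_smul]
    congr 2
    ext i
    rcases eq_or_ne i k with rfl | hi
    · simp [add_assoc]
    · simp [hi]

lemma measurable_prod_pow (y : Fin K → ℕ) : Measurable fun p : Fin K → ℝ => ∏ k, p k ^ y k :=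
  Finset.measurable_prod _ fun k _ => (measurable_pi_apply k).pow_const _

lemma prod_pow_mem_Icc {p : Fin K → ℝ} (h0 : ∀ k, 0 ≤ p k) (h1 : ∀ k, p k ≤ 1) (y : Fin K → ℕ) :
    ∏ k, p k ^ y k ∈ Set.Icc (0 : ℝ) 1 :=
  ⟨Finset.prod_nonneg fun k _ => pow_nonneg (h0 k) _,
    Finset.prod_le_one (fun k _ => pow_nonneg (h0 k) _) fun k _ => pow_le_one₀ (h0 k) (h1 k)⟩

lemma integrable_prod_pow_dirichletMeasure {a : Fin K → ℝ} (hs : 0 < ∑ k, a k) (y : Fin K → ℕ) :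
    Integrable (fun p => ∏ k, p k ^ y k) (dirichletMeasure a) := by
  refine Integrable.of_bound (C := 1)
    (measurable_prod_pow y).aestronglyMeasurable ?_
  filter_upwards [dirichletMeasure_nonneg a, dirichletMeasure_le_one hs] with p h0 h1
  have := prod_pow_mem_Icc h0 h1 y
  rw [Real.norm_of_nonneg this.1]
  exact this.2

lemma integrable_coord_dirichletMeasure {a : Fin K → ℝ} (hs : 0 < ∑ k, a k) (k : Fin K) :
    Integrable (fun p => p k) (dirichletMeasure a) := by
  refine Integrable.of_bound (C := 1) (measurable_pi_apply k).aestronglyMeasurable ?_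
  filter_upwards [dirichletMeasure_nonneg a, dirichletMeasure_le_one hs] with p h0 h1
  rw [Real.norm_of_nonneg (h0 k)]
  exact h1 k

lemma integrable_coord_mul_coord_dirichletMeasure {a : Fin K → ℝ} (hs : 0 < ∑ k, a k)
    (k l : Fin K) : Integrable (fun p => p k * p l) (dirichletMeasure a) := by
  refine Integrable.of_bound (C := 1) (by fun_prop) ?_
  filter_upwards [dirichletMeasure_nonneg a, dirichletMeasure_le_one hs] with p h0 h1
  rw [Real.norm_of_nonneg (mul_nonneg (h0 k) (h0 l))]
  exact mul_le_one₀ (h1 k) (h0 l) (h1 l)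

/-- Bayes' formula: `Dir(a + y)` is the posterior of `Dir(a)` under the likelihood `p ^ y`. -/
lemma setIntegral_prod_pow_dirichletMeasure {a : Fin K → ℝ} (ha : ∀ k, 0 ≤ a k)
    (hs : 0 < ∑ k, a k) (y : Fin K → ℕ) {A : Set (Fin K → ℝ)} (hA : MeasurableSet A) :
    ∫ p in A, ∏ k, p k ^ y k ∂dirichletMeasure a =
      (∫ p, ∏ k, p k ^ y k ∂dirichletMeasure a) *
        (dirichletMeasure fun k => a k + y k).real A := by
  obtain ⟨C, hC⟩ := exists_dirichletMeasure_withDensity_prod_pow y ha hs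
  have key : ∀ B : Set (Fin K → ℝ), MeasurableSet B →
      ∫ p in B, ∏ k, p k ^ y k ∂dirichletMeasure a =
        C.toReal * (dirichletMeasure fun k => a k + y k).real B := by
    intro B hB
    have hnn : 0 ≤ᵐ[(dirichletMeasure a).restrict B] fun p => ∏ k, p k ^ y k := by
      refine ae_restrict_of_ae ?_
      filter_upwards [dirichletMeasure_nonneg a] with p hp
      exact Finset.prod_nonneg fun k _ => pow_nonneg (hp k) _
    rw [integral_eq_lintegral_of_nonneg_ae hnn (measurable_prod_pow y).aestronglyMeasurable,
      measureReal_def,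
      ← ENNReal.toReal_mul, ← smul_eq_mul, ← Measure.smul_apply, ← hC, withDensity_apply _ hB]
    congr 1
    refine lintegral_congr_ae (ae_restrict_of_ae ?_)
    filter_upwards [dirichletMeasure_nonneg a] with p hp
    rw [ENNReal.ofReal_prod_of_nonneg fun k _ => pow_nonneg (hp k) _]
    exact Finset.prod_congr rfl fun k _ => ENNReal.ofReal_pow (hp k) _
  rw [key A hA, ← setIntegral_univ, key _ MeasurableSet.univ]
  simp

end Dirichlet

/-! ### Multinomial distributions -/

section Multinomial

variable {K : ℕ}

/-- The mass which `Mul(n; p)` gives to the vector `x`; it is `0` unless the entries of `x` sum to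
`n`. -/
noncomputable def multinomialMass (n : ℕ) (p : Fin K → ℝ) (x : Fin K → ℕ) : ℝ :=
  if x ∈ Finset.piAntidiag (Finset.univ : Finset (Fin K)) n then
    (Nat.multinomial Finset.univ x : ℝ) * ∏ k, p k ^ x k else 0

lemma multinomialMass_of_mem {n : ℕ} (p : Fin K → ℝ) {x : Fin K → ℕ}
    (hx : x ∈ Finset.piAntidiag (Finset.univ : Finset (Fin K)) n) :
    multinomialMass n p x = (Nat.multinomial Finset.univ x : ℝ) * ∏ k, p k ^ x k := if_pos hx

lemma sum_multinomialMass (n : ℕ) {p : Fin K → ℝ} (hp : ∑ k, p k = 1) :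
    ∑ x ∈ Finset.piAntidiag Finset.univ n, multinomialMass n p x = 1 := by
  rw [Finset.sum_congr rfl fun x hx => multinomialMass_of_mem p hx,
    ← Finset.sum_pow_eq_sum_piAntidiag, hp, one_pow]

open MvPolynomial in
/-- The Euler operator `X_k ∂_k` multiplies the monomial `X ^ x` by `x_k`. -/
lemma X_mul_pderiv_prod_pow (k : Fin K) (x : Fin K → ℕ) (r : ℝ) :
    X k * pderiv k (C r * ∏ i, X i ^ x i : MvPolynomial (Fin K) ℝ) =
      C (r * x k) * ∏ i, X i ^ x i := by
  have h : ∀ r : ℝ, (C r * ∏ i, X i ^ x i : MvPolynomial (Fin K) ℝ) =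
      monomial (Finsupp.equivFunOnFinite.symm x) r := by
    intro r
    rw [monomial_eq, Finsupp.prod_fintype _ _ (by simp)]
    simp
  rw [h, h, X_mul_pderiv_monomial, ← map_nsmul]
  simp [mul_comm]

open MvPolynomial in
lemma sum_multinomialMass_mul_coord (n : ℕ) {p : Fin K → ℝ} (hp : ∑ k, p k = 1) (k : Fin K) :
    ∑ x ∈ Finset.piAntidiag Finset.univ n, multinomialMass n p x * x k = n * p k := by
  have h := Finset.sum_pow_eq_sum_piAntidiag Finset.univ
    (fun i : Fin K => (X i : MvPolynomial (Fin K) ℝ)) n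
  -- Apply the Euler operator `X_k ∂_k` to the multinomial theorem, then evaluate at `p`.
  have h2 := congrArg (fun q => eval p (X k * pderiv k q)) h
  simp only [map_sum, Finset.mul_sum, ← map_natCast (C (σ := Fin K) (R := ℝ)),
    X_mul_pderiv_prod_pow] at h2
  simp [Derivation.leibniz_pow, pderiv_X, Pi.single_apply, hp] at h2
  rw [Finset.sum_congr rfl fun x hx => by rw [multinomialMass_of_mem p hx]]
  rw [mul_comm (n : ℝ), h2]
  refine Finset.sum_congr rfl fun x _ => by ring

open MvPolynomial in
lemma sum_multinomialMass_mul_coord_mul_coord (n : ℕ) {p : Fin K → ℝ} (hp : ∑ k, p k = 1)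
    (k l : Fin K) :
    ∑ x ∈ Finset.piAntidiag Finset.univ n, multinomialMass n p x * (x k * x l) =
      n * (n - 1) * (p k * p l) + if k = l then n * p k else 0 := by
  have h := Finset.sum_pow_eq_sum_piAntidiag Finset.univ
    (fun i : Fin K => (X i : MvPolynomial (Fin K) ℝ)) n
  have h2 := congrArg (fun q => eval p (X l * pderiv l (X k * pderiv k q))) h
  simp only [map_sum, Finset.mul_sum, ← map_natCast (C (σ := Fin K) (R := ℝ)),
    X_mul_pderiv_prod_pow] at h2
  have hn : (n : ℝ) * ((n - 1 : ℕ) : ℝ) = n * (n - 1) := by cases n <;> simp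
  simp [Derivation.leibniz_pow, Derivation.leibniz, pderiv_X, Pi.single_apply, hp] at h2
  rw [Finset.sum_congr rfl fun x hx => by rw [multinomialMass_of_mem p hx], ← hn]
  trans ∑ x ∈ Finset.piAntidiag Finset.univ n,
    (Nat.multinomial Finset.univ x : ℝ) * x k * x l * ∏ i, p i ^ x i
  · exact Finset.sum_congr rfl fun x _ => by ring
  · rw [← h2]
    split_ifs with hkl
    · subst hkl
      simp [hp]
      ring
    · simp
      ring

lemma multinomialMeasure_real_apply (n : ℕ) {p : Fin K → ℝ} (hp : ∀ k, 0 ≤ p k)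
    {A : Set (Fin K → ℝ)} (hA : MeasurableSet A) :
    (multinomialMeasure n p).real A = ∑ x ∈ Finset.piAntidiag Finset.univ n,
      multinomialMass n p x * A.indicator 1 (fun k => (x k : ℝ)) := by
  rw [multinomialMeasure, measureReal_def, Measure.finsetSum_apply, ENNReal.toReal_sum]
  · refine Finset.sum_congr rfl fun x hx => ?_
    rw [Measure.smul_apply, Measure.dirac_apply' _ hA, smul_eq_mul, ENNReal.toReal_mul,
      ENNReal.toReal_ofReal, multinomialMass_of_mem p hx]
    · congr 1
      by_cases h : (fun k => (x k : ℝ)) ∈ A <;> simp [h]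
    · exact mul_nonneg (Nat.cast_nonneg _) (Finset.prod_nonneg fun k _ => pow_nonneg (hp k) _)
  · intro x _
    rw [Measure.smul_apply, Measure.dirac_apply' _ hA, smul_eq_mul]
    exact ENNReal.mul_ne_top ENNReal.ofReal_ne_top (by
      by_cases h : (fun k => (x k : ℝ)) ∈ A <;> simp [h])

end Multinomial

/-! ### Conditional laws and conditional independence -/

section Conditional

variable {Ω 𝒱 𝒲 T : Type*} {m mΩ : MeasurableSpace Ω} {P : Measure Ω}
  [MeasurableSpace 𝒱] [MeasurableSpace 𝒲] [Fintype T]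

lemma CondIndepFamily.map {V : T → Ω → 𝒱} (h : CondIndepFamily m V P) {f : 𝒱 → 𝒲}
    (hf : Measurable f) : CondIndepFamily m (fun t ω => f (V t ω)) P :=
  fun A hA => h (fun t => f ⁻¹' A t) fun t => hf (hA t)

variable [IsProbabilityMeasure P]

/-- A subfamily of a conditionally independent family is conditionally independent: the other
members are tested against the whole space. -/
lemma CondIndepFamily.comp_injective {V : T → Ω → 𝒱} (h : CondIndepFamily m V P) (hm : m ≤ mΩ)
    {J : Type*} [Fintype J] {e : J → T} (he : Function.Injective e) :
    CondIndepFamily m (fun j => V (e j)) P := by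
  intro A hA
  have hA' : ∀ t, MeasurableSet (Function.extend e A (fun _ => Set.univ) t) := by
    intro t
    by_cases ht : ∃ j, e j = t
    · obtain ⟨j, rfl⟩ := ht
      rw [he.extend_apply]
      exact hA j
    · rw [Function.extend_apply' _ _ _ ht]
      exact MeasurableSet.univ
  have hI : ⋂ t, V t ⁻¹' Function.extend e A (fun _ => Set.univ) t = ⋂ j, V (e j) ⁻¹' A j := by
    ext ω
    simp only [Set.mem_iInter, Set.mem_preimage]
    refine ⟨fun hω j => ?_, fun hω t => ?_⟩
    · have := hω (e j)
      rwa [he.extend_apply] at this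
    · by_cases ht : ∃ j, e j = t
      · obtain ⟨j, rfl⟩ := ht
        rw [he.extend_apply]
        exact hω j
      · rw [Function.extend_apply' _ _ _ ht]
        trivial
  have h1 := h _ hA'
  rw [hI] at h1
  filter_upwards [h1] with ω hω
  rw [hω]
  refine (Fintype.prod_of_injective e he _ _ (fun t ht => ?_) fun j => ?_).symm
  · have ht' : ¬ ∃ j, e j = t := ht
    have hu : (V t ⁻¹' Set.univ).indicator (fun _ : Ω => (1 : ℝ)) = fun _ => 1 := by simp
    rw [Function.extend_apply' _ _ _ ht', hu, condExp_const hm]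
  · rw [he.extend_apply]

/-- The joint law of a conditionally independent family, on an event of the conditioning
σ-algebra. -/
lemma CondIndepFamily.measureReal_inter_iInter {V : T → Ω → 𝒱} (h : CondIndepFamily m V P)
    (hm : m ≤ mΩ) (hV : ∀ t, Measurable (V t)) {κ : T → Ω → Measure 𝒱}
    (hκ : ∀ t, HasCondLaw m (V t) (κ t) P) {S : Set Ω} (hS : MeasurableSet[m] S)
    {A : T → Set 𝒱} (hA : ∀ t, MeasurableSet (A t)) :
    P.real (S ∩ ⋂ t, V t ⁻¹' A t) = ∫ ω in S, ∏ t, (κ t ω).real (A t) ∂P := by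
  have hE : MeasurableSet (⋂ t, V t ⁻¹' A t) := MeasurableSet.iInter fun t => hV t (hA t)
  have h2 := setIntegral_condExp hm (μ := P) (f := (⋂ t, V t ⁻¹' A t).indicator fun _ => (1 : ℝ))
    ((integrable_const 1).indicator hE) hS
  rw [setIntegral_indicator hE, setIntegral_const, smul_eq_mul, mul_one] at h2
  rw [← h2]
  refine setIntegral_congr_ae (hm _ hS) ?_
  filter_upwards [h A hA, ae_all_iff.2 fun t => hκ t (A t) (hA t)] with ω h3 h4 _
  rw [h3]
  exact Finset.prod_congr rfl fun t _ => h4 t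

lemma HasCondLaw.measureReal_inter {V : Ω → 𝒱} {κ : Ω → Measure 𝒱} (hκ : HasCondLaw m V κ P)
    (hm : m ≤ mΩ) (hV : Measurable V) {S : Set Ω} (hS : MeasurableSet[m] S)
    {A : Set 𝒱} (hA : MeasurableSet A) :
    P.real (S ∩ V ⁻¹' A) = ∫ ω in S, (κ ω).real A ∂P := by
  have hE : MeasurableSet (V ⁻¹' A) := hV hA
  have h2 := setIntegral_condExp hm (μ := P) (f := (V ⁻¹' A).indicator fun _ => (1 : ℝ))
    ((integrable_const 1).indicator hE) hS
  rw [setIntegral_indicator hE, setIntegral_const, smul_eq_mul, mul_one] at h2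
  rw [← h2]
  refine setIntegral_congr_ae (hm _ hS) ?_
  filter_upwards [hκ A hA] with ω h4 _
  exact h4

/-- On an event of the conditioning σ-algebra where the conditional laws are constant, two
conditionally independent variables are independent. -/
lemma CondIndepFamily.setIntegral_mul {V : T → Ω → 𝒱} (h : CondIndepFamily m V P)
    (hm : m ≤ mΩ) (hV : ∀ t, Measurable (V t)) {κ : T → Ω → Measure 𝒱}
    (hκ : ∀ t, HasCondLaw m (V t) (κ t) P) {S : Set Ω} (hS : MeasurableSet[m] S)
    {ν : T → Measure 𝒱} [∀ t, IsProbabilityMeasure (ν t)] (hν : ∀ t, ∀ ω ∈ S, κ t ω = ν t)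
    {t t' : T} (htt' : t ≠ t') {f g : 𝒱 → ℝ} (hf : Measurable f) (hg : Measurable g) :
    ∫ ω in S, f (V t ω) * g (V t' ω) ∂P =
      P.real S * ((∫ v, f v ∂ν t) * ∫ v, g v ∂ν t') := by
  have hpair : Measurable fun ω => (V t ω, V t' ω) := (hV t).prodMk (hV t')
  have he : Function.Injective ![t, t'] := by
    intro i j hij
    fin_cases i <;> fin_cases j <;> simp_all
  have hmap : (P.restrict S).map (fun ω => (V t ω, V t' ω)) = P S • (ν t).prod (ν t') := by
    refine Measure.ext_prod fun {A B} hA hB => ?_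
    rw [Measure.map_apply hpair (hA.prod hB), Measure.restrict_apply (hpair (hA.prod hB)),
      Measure.smul_apply, Measure.prod_prod, smul_eq_mul]
    have h1 := (h.comp_injective hm he).measureReal_inter_iInter hm (fun j => hV _)
      (fun j => hκ _) hS (A := ![A, B]) (fun j => by fin_cases j <;> assumption)
    have h2 : ∫ ω in S, ∏ j, (κ (![t, t'] j) ω).real (![A, B] j) ∂P =
        ∫ _ in S, (ν t).real A * (ν t').real B ∂P := by
      refine setIntegral_congr_fun (hm _ hS) fun ω hω => ?_
      simp [Fin.prod_univ_two, hν _ ω hω]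
    rw [h2, setIntegral_const, smul_eq_mul] at h1
    have h3 : (fun ω => (V t ω, V t' ω)) ⁻¹' A ×ˢ B ∩ S =
        S ∩ ⋂ j, V (![t, t'] j) ⁻¹' ![A, B] j := by
      ext ω
      simp [Fin.forall_fin_two, and_comm]
    rw [h3, ← ofReal_measureReal, h1, ENNReal.ofReal_mul measureReal_nonneg,
      ENNReal.ofReal_mul measureReal_nonneg, ofReal_measureReal, ofReal_measureReal,
      ofReal_measureReal]
  have h1 := integral_map (μ := P.restrict S) hpair.aemeasurable
    (f := fun z : 𝒱 × 𝒱 => f z.1 * g z.2)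
    ((hf.comp measurable_fst).mul (hg.comp measurable_snd)).aestronglyMeasurable
  rw [← h1, hmap, integral_smul_measure, integral_prod_mul, smul_eq_mul, measureReal_def]

end Conditional

/-! ### Mixed multinomial counts -/

section Counts

variable {Ω : Type*} {K : ℕ}

/-- The vector of natural numbers `x`, as a real vector. -/
def castVec (x : Fin K → ℕ) : Fin K → ℝ := fun k => x k

lemma castVec_injective : Function.Injective (castVec (K := K)) := fun x y h => by
  ext k
  exact Nat.cast_injective (R := ℝ) (congrFun h k)

/-- The event that the count vectors `U j` take the values `x j`. -/
def countEvent {J : Type*} (U : J → Ω → Fin K → ℝ) (x : J → Fin K → ℕ) : Set Ω :=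
  ⋂ j, U j ⁻¹' {castVec (x j)}

/-- The possible values of a family of multinomial vectors with sizes `c`. -/
def countRange (K : ℕ) {J : Type*} [Fintype J] [DecidableEq J] (c : J → ℕ) :
    Finset (J → Fin K → ℕ) :=
  Fintype.piFinset fun j => Finset.piAntidiag Finset.univ (c j)

lemma mem_countEvent {J : Type*} {U : J → Ω → Fin K → ℝ} {x : J → Fin K → ℕ} {ω : Ω} :
    ω ∈ countEvent U x ↔ ∀ j, U j ω = castVec (x j) := by simp [countEvent]

lemma measurableSet_countEvent {J : Type*} [Fintype J] {m : MeasurableSpace Ω}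
    {U : J → Ω → Fin K → ℝ} (hU : ∀ j, Measurable (U j)) (x : J → Fin K → ℕ) :
    MeasurableSet (countEvent U x) :=
  MeasurableSet.iInter fun j => hU j (measurableSet_singleton _)

variable {m mΩ : MeasurableSpace Ω} {P : Measure Ω}

section Decomposition

variable {J : Type*} [Fintype J] {c : J → ℕ} {U : J → Ω → Fin K → ℝ}

/-- Almost surely exactly one of the events `countEvent U x` occurs, so that `P` is the sum of its
restrictions to them. -/
lemma eq_sum_restrict_countEvent [DecidableEq J] (hU : ∀ j, Measurable (U j))
    (hae : ∀ j, ∀ᵐ ω ∂P, ∃ x ∈ Finset.piAntidiag Finset.univ (c j), U j ω = castVec x) :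
    P = ∑ x ∈ countRange K c, P.restrict (countEvent U x) := by
  have hcov : ∀ᵐ ω ∂P, ω ∈ ⋃ x ∈ countRange K c, countEvent U x := by
    filter_upwards [ae_all_iff.2 hae] with ω hω
    choose x hx hxω using hω
    exact Set.mem_biUnion (show x ∈ (countRange K c : Set _) from Fintype.mem_piFinset.2 hx)
      (mem_countEvent.2 hxω)
  have hdisj : Pairwise fun x y => Disjoint (countEvent U x) (countEvent U y) := by
    intro x y hxy
    refine Set.disjoint_left.2 fun ω h1 h2 => hxy ?_
    ext1 j
    exact castVec_injective ((mem_countEvent.1 h1 j).symm.trans (mem_countEvent.1 h2 j))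
  ext E hE
  rw [Measure.finsetSum_apply]
  simp only [Measure.restrict_apply hE]
  rw [← measure_biUnion_finset (fun x _ y _ hxy => (hdisj hxy).mono
    Set.inter_subset_right Set.inter_subset_right)
    fun x _ => hE.inter (measurableSet_countEvent hU x), ← Set.inter_iUnion₂]
  refine measure_congr ?_
  filter_upwards [hcov] with ω hω
  exact propext ⟨fun h => ⟨h, hω⟩, fun h => h.1⟩

lemma sum_integral_countEvent [DecidableEq J] (hU : ∀ j, Measurable (U j))
    (hae : ∀ j, ∀ᵐ ω ∂P, ∃ x ∈ Finset.piAntidiag Finset.univ (c j), U j ω = castVec x)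
    {f : Ω → ℝ} (hf : Integrable f P) :
    ∫ ω, f ω ∂P = ∑ x ∈ countRange K c, ∫ ω in countEvent U x, f ω ∂P := by
  conv_lhs => rw [eq_sum_restrict_countEvent hU hae]
  exact integral_finsetSum_measure fun x _ => hf.restrict

end Decomposition

/-- Counts from the first two levels of the hierarchy, for a fixed partition: the weights `γ` have
law `Dir(a)` and are the parameters of the vectors `U j`, which given `m` are independent with
`U j ~ Mul(c j; γ)`. -/
structure MixedCounts {J : Type*} [Fintype J] (m : MeasurableSpace Ω) {mΩ : MeasurableSpace Ω}
    (a : Fin K → ℝ) (c : J → ℕ) (γ : Ω → Fin K → ℝ) (U : J → Ω → Fin K → ℝ) (P : Measure Ω) :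
    Prop where
  le : m ≤ mΩ
  nonneg : ∀ k, 0 ≤ a k
  sum_pos : 0 < ∑ k, a k
  hasLaw : HasLaw γ (dirichletMeasure a) P
  measurable : ∀ j, Measurable (U j)
  condIndep : CondIndepFamily m U P
  condLaw : ∀ j, HasCondLaw m (U j) (fun ω => multinomialMeasure (c j) (γ ω)) P

namespace MixedCounts

variable {J : Type*} [Fintype J] {a : Fin K → ℝ} {c : J → ℕ} {γ : Ω → Fin K → ℝ}
  {U : J → Ω → Fin K → ℝ}

lemma weights_nonneg (h : MixedCounts m a c γ U P) : ∀ᵐ ω ∂P, ∀ k, 0 ≤ γ ω k := by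
  have := dirichletMeasure_nonneg a
  rw [← h.hasLaw.map_eq] at this
  exact ae_of_ae_map h.hasLaw.aemeasurable this

lemma weights_sum_eq_one (h : MixedCounts m a c γ U P) : ∀ᵐ ω ∂P, ∑ k, γ ω k = 1 := by
  have := dirichletMeasure_sum_eq_one h.sum_pos
  rw [← h.hasLaw.map_eq] at this
  exact ae_of_ae_map h.hasLaw.aemeasurable this

variable [IsProbabilityMeasure P]

lemma comp_injective (h : MixedCounts m a c γ U P) {I : Type*} [Fintype I] {e : I → J}
    (he : Function.Injective e) :
    MixedCounts m a (fun i => c (e i)) γ (fun i => U (e i)) P where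
  le := h.le
  nonneg := h.nonneg
  sum_pos := h.sum_pos
  hasLaw := h.hasLaw
  measurable i := h.measurable (e i)
  condIndep := h.condIndep.comp_injective h.le he
  condLaw i := h.condLaw (e i)

/-- Almost surely, the entries of the `j`-th count vector are natural numbers with sum `c j`. -/
lemma ae_exists (h : MixedCounts m a c γ U P) (j : J) :
    ∀ᵐ ω ∂P, ∃ x ∈ Finset.piAntidiag Finset.univ (c j), U j ω = castVec x := by
  set R : Set (Fin K → ℝ) :=
    castVec '' ↑(Finset.piAntidiag (Finset.univ : Finset (Fin K)) (c j)) with hR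
  have hRm : MeasurableSet R := ((Finset.finite_toSet _).image _).measurableSet
  have h1 := (h.condLaw j).measureReal_inter h.le (h.measurable j) MeasurableSet.univ hRm
  have h2 : ∫ ω in Set.univ, (multinomialMeasure (c j) (γ ω)).real R ∂P = ∫ _ : Ω, 1 ∂P := by
    rw [setIntegral_univ]
    refine integral_congr_ae ?_
    filter_upwards [h.weights_nonneg, h.weights_sum_eq_one] with ω h3 h4
    rw [multinomialMeasure_real_apply (c j) h3 hRm, ← sum_multinomialMass (c j) h4]
    refine Finset.sum_congr rfl fun x hx => ?_
    rw [Set.indicator_of_mem (show (fun k => (x k : ℝ)) ∈ R from ⟨x, hx, rfl⟩)]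
    simp
  rw [h2, Set.univ_inter] at h1
  have h3 : P (U j ⁻¹' R) = 1 := by
    rw [← ofReal_measureReal, h1]
    simp
  have h4 : ∀ᵐ ω ∂P, ω ∈ U j ⁻¹' R := (mem_ae_iff_prob_eq_one (h.measurable j hRm)).2 h3
  filter_upwards [h4] with ω hω
  obtain ⟨x, hx, hxω⟩ := hω
  exact ⟨x, hx, hxω.symm⟩

/-- The joint law of conditionally independent multinomial vectors with Dirichlet weights. -/
lemma measureReal_countEvent (h : MixedCounts m a c γ U P) (x : J → Fin K → ℕ) :
    P.real (countEvent U x) = ∫ p, ∏ j, multinomialMass (c j) p (x j) ∂dirichletMeasure a := by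
  have h1 := h.condIndep.measureReal_inter_iInter h.le h.measurable h.condLaw MeasurableSet.univ
    (A := fun j => {castVec (x j)}) (fun j => measurableSet_singleton _)
  rw [Set.univ_inter, setIntegral_univ] at h1
  have hmeas : Measurable fun p : Fin K → ℝ => ∏ j, multinomialMass (c j) p (x j) := by
    refine Finset.measurable_prod _ fun j _ => ?_
    unfold multinomialMass
    split_ifs
    · exact (measurable_prod_pow _).const_mul _
    · exact measurable_const
  rw [countEvent, h1, ← h.hasLaw.map_eq,
    integral_map h.hasLaw.aemeasurable hmeas.aestronglyMeasurable]
  refine integral_congr_ae ?_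
  filter_upwards [h.weights_nonneg] with ω h3
  refine Finset.prod_congr rfl fun j _ => ?_
  rw [multinomialMeasure_real_apply _ h3 (measurableSet_singleton _)]
  by_cases hx : x j ∈ Finset.piAntidiag Finset.univ (c j)
  · rw [Finset.sum_eq_single_of_mem _ hx]
    · rw [Set.indicator_of_mem (show (fun k => ((x j) k : ℝ)) ∈ ({castVec (x j)} : Set _) from rfl)]
      simp
    · intro y _ hy
      rw [Set.indicator_of_notMem, mul_zero]
      exact fun h => hy (castVec_injective h)
  · rw [multinomialMass, if_neg hx]
    refine Finset.sum_eq_zero fun y hy => ?_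
    rw [Set.indicator_of_notMem, mul_zero]
    intro hxy
    exact hx (castVec_injective hxy ▸ hy)

end MixedCounts

end Counts

section Counts

variable {Ω : Type*} {K : ℕ}

/-- The covariance between coordinates `k` and `l` of a `Dir(a)` vector. -/
noncomputable def dirichletCov (a : Fin K → ℝ) (k l : Fin K) : ℝ :=
  a k / (∑ i, a i) * ((a l + if k = l then 1 else 0) / ((∑ i, a i) + 1)) -
    a k / (∑ i, a i) * (a l / ∑ i, a i)

section Mixture

variable {mΩ : MeasurableSpace Ω} {P : Measure Ω} {a : Fin K → ℝ}
  {J : Type*} [Fintype J] {c : J → ℕ} {U : J → Ω → Fin K → ℝ}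

lemma prod_multinomialMass [DecidableEq J] {x : J → Fin K → ℕ} (hx : x ∈ countRange K c)
    (p : Fin K → ℝ) :
    ∏ j, multinomialMass (c j) p (x j) =
      (∏ j, (Nat.multinomial Finset.univ (x j) : ℝ)) * ∏ k, p k ^ ∑ j, x j k := by
  rw [Finset.prod_congr rfl fun j _ => multinomialMass_of_mem p (Fintype.mem_piFinset.1 hx j),
    Finset.prod_mul_distrib, Finset.prod_comm]
  simp only [Finset.prod_pow_eq_pow_sum]

lemma integrable_prod_multinomialMass [DecidableEq J] (hs : 0 < ∑ k, a k) {x : J → Fin K → ℕ}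
    (hx : x ∈ countRange K c) :
    Integrable (fun p => ∏ j, multinomialMass (c j) p (x j)) (dirichletMeasure a) := by
  simp only [prod_multinomialMass hx]
  exact (integrable_prod_pow_dirichletMeasure hs _).const_mul _

/-- Averaging the posterior over the counts returns the prior: the mixture of the laws
`Dir(a + ∑ j, x j)` over the mixed multinomial law of the counts is `Dir(a)`. -/
lemma sum_integral_mul_dirichletMeasure_real [DecidableEq J] (ha : ∀ k, 0 ≤ a k)
    (hs : 0 < ∑ k, a k) {A : Set (Fin K → ℝ)} (hA : MeasurableSet A) :
    ∑ x ∈ countRange K c, (∫ p, ∏ j, multinomialMass (c j) p (x j) ∂dirichletMeasure a) *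
      (dirichletMeasure fun k => a k + ∑ j, (x j k : ℝ)).real A = (dirichletMeasure a).real A := by
  have h1 : ∀ x ∈ countRange K c,
      (∫ p, ∏ j, multinomialMass (c j) p (x j) ∂dirichletMeasure a) *
        (dirichletMeasure fun k => a k + ∑ j, (x j k : ℝ)).real A =
      ∫ p in A, ∏ j, multinomialMass (c j) p (x j) ∂dirichletMeasure a := by
    intro x hx
    simp only [prod_multinomialMass hx]
    rw [integral_const_mul, integral_const_mul,
      setIntegral_prod_pow_dirichletMeasure ha hs _ hA, mul_assoc]
    simp only [Nat.cast_sum]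
  rw [Finset.sum_congr rfl h1, ← integral_finsetSum _ fun x hx =>
    (integrable_prod_multinomialMass hs hx).restrict]
  have h2 : ∫ p in A, ∑ x ∈ countRange K c, ∏ j, multinomialMass (c j) p (x j)
      ∂dirichletMeasure a = ∫ _ in A, (1 : ℝ) ∂dirichletMeasure a := by
    refine integral_congr_ae (ae_restrict_of_ae ?_)
    filter_upwards [dirichletMeasure_sum_eq_one hs] with p hp
    rw [countRange, ← Finset.prod_univ_sum]
    exact Finset.prod_eq_one fun j _ => sum_multinomialMass _ hp
  rw [h2]
  simp

section Discrete

variable [DecidableEq J] {f : Ω → ℝ} {φ : (J → Fin K → ℕ) → ℝ}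

lemma integrable_of_counts [IsFiniteMeasure P] (hU : ∀ j, Measurable (U j))
    (hae : ∀ j, ∀ᵐ ω ∂P, ∃ x ∈ Finset.piAntidiag Finset.univ (c j), U j ω = castVec x)
    (hf : ∀ x, ∀ ω ∈ countEvent U x, f ω = φ x) : Integrable f P := by
  rw [eq_sum_restrict_countEvent hU hae]
  refine integrable_finsetSum_measure.2 fun x _ => ?_
  refine (integrable_const (φ x)).congr ?_
  filter_upwards [ae_restrict_mem (measurableSet_countEvent hU x)] with ω hω
  exact (hf x ω hω).symm

lemma integral_eq_sum_counts [IsFiniteMeasure P] (hU : ∀ j, Measurable (U j))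
    (hae : ∀ j, ∀ᵐ ω ∂P, ∃ x ∈ Finset.piAntidiag Finset.univ (c j), U j ω = castVec x)
    (hf : ∀ x, ∀ ω ∈ countEvent U x, f ω = φ x) :
    ∫ ω, f ω ∂P = ∑ x ∈ countRange K c, P.real (countEvent U x) * φ x := by
  rw [sum_integral_countEvent hU hae (integrable_of_counts hU hae hf)]
  refine Finset.sum_congr rfl fun x _ => ?_
  rw [setIntegral_congr_fun (measurableSet_countEvent hU x) (hf x), setIntegral_const, smul_eq_mul]

end Discrete

end Mixture

namespace MixedCounts

variable {m mΩ : MeasurableSpace Ω} {P : Measure Ω} [IsProbabilityMeasure P]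
  {a : Fin K → ℝ} {J : Type*} [Fintype J] {c : J → ℕ} {γ : Ω → Fin K → ℝ}
  {U : J → Ω → Fin K → ℝ}

/-- Given the weights, the mean of a product of functions of the separate count vectors is the
product of their multinomial means. -/
lemma integral_prod_counts (h : MixedCounts m a c γ U P) (g : J → (Fin K → ℝ) → ℝ) :
    ∫ ω, ∏ j, g j (U j ω) ∂P = ∫ p, ∏ j, ∑ x ∈ Finset.piAntidiag Finset.univ (c j),
      multinomialMass (c j) p x * g j (castVec x) ∂dirichletMeasure a := by
  classical
  rw [integral_eq_sum_counts (φ := fun x => ∏ j, g j (castVec (x j))) h.measurable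
    h.ae_exists fun x ω hω => Finset.prod_congr rfl
      fun j _ => by rw [mem_countEvent.1 hω j]]
  simp only [Finset.prod_univ_sum, Finset.prod_mul_distrib]
  rw [← countRange, integral_finsetSum _ fun x hx =>
    (integrable_prod_multinomialMass h.sum_pos hx).mul_const _]
  refine Finset.sum_congr rfl fun x _ => ?_
  rw [h.measureReal_countEvent, integral_mul_const]

lemma memLp_count (h : MixedCounts m a c γ U P) (j : J) (k : Fin K) :
    MemLp (fun ω => U j ω k) 2 P := by
  refine MemLp.of_bound ((measurable_pi_apply k).comp (h.measurable j)).aestronglyMeasurable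
    (c j) ?_
  filter_upwards [h.ae_exists j] with ω hω
  obtain ⟨x, hx, hxω⟩ := hω
  rw [hxω, castVec, Real.norm_of_nonneg (Nat.cast_nonneg _), Nat.cast_le,
    ← (Finset.mem_piAntidiag.1 hx).1]
  exact Finset.single_le_sum (fun i _ => Nat.zero_le _) (Finset.mem_univ k)

lemma integral_count (h : MixedCounts m a c γ U P) (j : J) (k : Fin K) :
    ∫ ω, U j ω k ∂P = c j * (a k / ∑ i, a i) := by
  have he : Function.Injective fun _ : Unit => j := Function.injective_of_subsingleton _
  have h1 := (h.comp_injective he).integral_prod_counts (fun _ v => v k)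
  simp only [Finset.univ_unique, Finset.prod_singleton] at h1
  rw [h1, ← integral_coord_dirichletMeasure h.nonneg h.sum_pos, ← integral_const_mul]
  refine integral_congr_ae ?_
  filter_upwards [dirichletMeasure_sum_eq_one h.sum_pos] with p hp
  exact sum_multinomialMass_mul_coord _ hp k

lemma integral_count_mul_count_of_ne (h : MixedCounts m a c γ U P) {j j' : J}
    (hj : j ≠ j') (k l : Fin K) :
    ∫ ω, U j ω k * U j' ω l ∂P = c j * c j' *
      (a k / (∑ i, a i) * ((a l + if k = l then 1 else 0) / ((∑ i, a i) + 1))) := by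
  have he : Function.Injective ![j, j'] := by
    intro i i' hij
    fin_cases i <;> fin_cases i' <;> simp_all
  have h1 := (h.comp_injective he).integral_prod_counts ![fun v => v k, fun v => v l]
  simp only [Fin.prod_univ_two, Matrix.cons_val_zero, Matrix.cons_val_one] at h1
  rw [h1, ← integral_coord_mul_coord_dirichletMeasure h.nonneg h.sum_pos, ← integral_const_mul]
  refine integral_congr_ae ?_
  filter_upwards [dirichletMeasure_sum_eq_one h.sum_pos] with p hp
  rw [mul_mul_mul_comm]
  exact congrArg₂ _ (sum_multinomialMass_mul_coord _ hp k) (sum_multinomialMass_mul_coord _ hp l)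

/-- The joint second moments of one count vector; the family is restricted to a single index. -/
lemma integral_count_mul_count_self (h : MixedCounts m a c γ U P) (j : J) (k l : Fin K) :
    ∫ ω, U j ω k * U j ω l ∂P = c j * (c j - 1) *
      (a k / (∑ i, a i) * ((a l + if k = l then 1 else 0) / ((∑ i, a i) + 1))) +
      if k = l then c j * (a k / ∑ i, a i) else 0 := by
  have he : Function.Injective fun _ : Unit => j := Function.injective_of_subsingleton _
  have h1 := (h.comp_injective he).integral_prod_counts (fun _ v => v k * v l)
  simp only [Finset.univ_unique, Finset.prod_singleton] at h1
  have hint1 := integrable_coord_dirichletMeasure h.sum_pos k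
  have hint2 := integrable_coord_mul_coord_dirichletMeasure h.sum_pos k l
  have h2 : ∫ ω, U j ω k * U j ω l ∂P = ∫ p, (c j * (c j - 1) * (p k * p l) +
      if k = l then c j * p k else 0) ∂dirichletMeasure a := by
    rw [h1]
    refine integral_congr_ae ?_
    filter_upwards [dirichletMeasure_sum_eq_one h.sum_pos] with p hp
    exact sum_multinomialMass_mul_coord_mul_coord _ hp k l
  rw [h2, ← integral_coord_mul_coord_dirichletMeasure h.nonneg h.sum_pos, ← integral_const_mul,
    ← integral_coord_dirichletMeasure h.nonneg h.sum_pos, ← integral_const_mul]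
  split_ifs
  · rw [integral_add (hint2.const_mul _) (hint1.const_mul _)]
  · simp

lemma covariance_count [DecidableEq J] (h : MixedCounts m a c γ U P) (j j' : J) (k l : Fin K) :
    cov[fun ω => U j ω k, fun ω => U j' ω l; P] =
      (c j * c j' + if j = j' then (∑ i, a i) * c j else 0) * dirichletCov a k l := by
  rw [covariance_eq_sub (h.memLp_count j k)
    (h.memLp_count j' l), h.integral_count,
    h.integral_count]
  have hs0 := h.sum_pos.ne'
  have hs1 : (∑ i, a i) + 1 ≠ 0 := (add_pos h.sum_pos one_pos).ne'
  by_cases hj : j = j'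
  · subst hj
    rw [if_pos rfl]
    have := h.integral_count_mul_count_self j k l
    simp only [Pi.mul_apply]
    rw [this, dirichletCov]
    split_ifs <;> field_simp <;> ring
  · rw [if_neg hj]
    have := h.integral_count_mul_count_of_ne hj k l
    simp only [Pi.mul_apply]
    rw [this, dirichletCov]
    ring

lemma covariance_sum_count [DecidableEq J] (h : MixedCounts m a c γ U P) 
    (s s' : Finset J) (k l : Fin K) :
    cov[fun ω => ∑ j ∈ s, U j ω k, fun ω => ∑ j ∈ s', U j ω l; P] =
      ((∑ j ∈ s, (c j : ℝ)) * (∑ j ∈ s', (c j : ℝ)) +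
        (∑ i, a i) * ∑ j ∈ s ∩ s', (c j : ℝ)) * dirichletCov a k l := by
  rw [covariance_fun_sum_fun_sum' (fun j _ => h.memLp_count j k)
    (fun j _ => h.memLp_count j l)]
  simp only [h.covariance_count, ← Finset.sum_mul, Finset.sum_add_distrib, Finset.sum_ite_eq]
  rw [Finset.sum_mul_sum, Finset.mul_sum]
  rw [← Finset.sum_filter, Finset.filter_mem_eq_inter]

end MixedCounts

end Counts

/-! ### The three-level model on a fixed partition -/

lemma measurable_massVector {X : Type*} [MeasurableSpace X] {K : ℕ} {B : Fin K → Set X}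
    (hB : IsMeasurablePartition B) : Measurable (massVector B) :=
  measurable_pi_lambda _ fun k => (Measure.measurable_coe (hB.measurableSet k)).ennreal_toReal

lemma IsMeasurablePartition.sum_real {X : Type*} [MeasurableSpace X] {K : ℕ} {B : Fin K → Set X}
    (hB : IsMeasurablePartition B) (μ : Measure X) [IsProbabilityMeasure μ] :
    ∑ k, μ.real (B k) = 1 := by
  have h := measureReal_biUnion_finset (μ := μ) (s := Finset.univ) (f := B)
    (fun i _ j _ hij => hB.disjoint hij) fun k _ => hB.measurableSet k
  rw [← h]
  simp [hB.iUnion_eq]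

lemma isMeasurablePartition_compl {X : Type*} [MeasurableSpace X] {B : Set X}
    (hB : MeasurableSet B) : IsMeasurablePartition ![B, Bᶜ] where
  measurableSet k := by
    fin_cases k
    exacts [hB, hB.compl]
  disjoint i j hij := by
    fin_cases i <;> fin_cases j
    exacts [absurd rfl hij, disjoint_compl_right, disjoint_compl_left, absurd rfl hij]
  iUnion_eq := by
    ext x
    simp [Fin.exists_fin_two, em]

lemma isMeasurablePartition_of_disjoint {X : Type*} [MeasurableSpace X] {B₁ B₂ : Set X}
    (h₁ : MeasurableSet B₁) (h₂ : MeasurableSet B₂) (hd : Disjoint B₁ B₂) :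
    IsMeasurablePartition ![B₁, B₂, (B₁ ∪ B₂)ᶜ] where
  measurableSet k := by
    fin_cases k
    exacts [h₁, h₂, (h₁.union h₂).compl]
  disjoint i j hij := by
    have h1 : Disjoint B₁ (B₁ ∪ B₂)ᶜ := disjoint_compl_right.mono_left Set.subset_union_left
    have h2 : Disjoint B₂ (B₁ ∪ B₂)ᶜ := disjoint_compl_right.mono_left Set.subset_union_right
    fin_cases i <;> fin_cases j
    exacts [absurd rfl hij, hd, h1, hd.symm, absurd rfl hij, h2, h1.symm, h2.symm, absurd rfl hij]
  iUnion_eq := by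
    ext x
    simp only [Set.mem_iUnion, Fin.exists_fin_succ, Set.mem_univ, iff_true]
    by_cases hx : x ∈ B₁ <;> by_cases hx' : x ∈ B₂ <;> simp [hx, hx']

lemma HasCondLaw.congr {Ω 𝒱 : Type*} [MeasurableSpace 𝒱] {m mΩ : MeasurableSpace Ω} {P : Measure Ω}
    {V : Ω → 𝒱} {κ κ' : Ω → Measure 𝒱} (h : HasCondLaw m V κ P) (hκ : ∀ᵐ ω ∂P, κ ω = κ' ω) :
    HasCondLaw m V κ' P := by
  intro A hA
  filter_upwards [h A hA, hκ] with ω h1 h2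
  rw [h1, h2]

section Prior

variable {X : Type*} [MeasurableSpace X] {F₀ : Measure X} [IsProbabilityMeasure F₀] {c₀ : ℝ}
  {K : ℕ} {B : Fin K → Set X}

lemma sum_prior (hB : IsMeasurablePartition B) : ∑ k, c₀ * F₀.real (B k) = c₀ := by
  rw [← Finset.mul_sum, hB.sum_real, mul_one]

lemma dirichletCov_prior (hc₀ : 0 < c₀) (hB : IsMeasurablePartition B) (k l : Fin K) :
    dirichletCov (fun k => c₀ * F₀.real (B k)) k l =
      ((if k = l then F₀.real (B k) else 0) - F₀.real (B k) * F₀.real (B l)) / (c₀ + 1) := by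
  have : c₀ + 1 ≠ 0 := by positivity
  rw [dirichletCov, sum_prior hB]
  split_ifs <;> field_simp <;> ring

end Prior

lemma updatedPrecision_pos {T : Type*} {c₀ : ℝ} {c : T → ℕ} (hc₀ : 0 < c₀) (s : Finset T) :
    0 < updatedPrecision c₀ c s :=
  add_pos_of_pos_of_nonneg hc₀ (Finset.sum_nonneg fun _ _ => Nat.cast_nonneg _)

lemma measurable_massVector_comap {Ω X T : Type*} [MeasurableSpace X]
    {N : T → Ω → Measure X} {K : ℕ} {B : Fin K → Set X} (hB : IsMeasurablePartition B) (j : T) :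
    Measurable[MeasurableSpace.comap (fun ω t => N t ω) inferInstance]
      (fun ω : Ω => massVector B (N j ω)) :=
  ((measurable_massVector hB).comp (measurable_pi_apply (X := fun _ : T => Measure X) j)).comp
    (comap_measurable fun (ω : Ω) t => N t ω)

namespace IsDDP

variable {Ω X T : Type*} [MeasurableSpace Ω] [MeasurableSpace X] [Fintype T]
  {P : Measure Ω} {F₀ : Measure X}
  {c₀ : ℝ} {c : T → ℕ} {nb : T → Finset T} {G : Ω → Measure X} {N F : T → Ω → Measure X}
  {K : ℕ} {B : Fin K → Set X}

lemma comap_le (h : IsDDP c₀ c nb F₀ G N F P) :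
    MeasurableSpace.comap (fun ω t => N t ω) inferInstance ≤ ‹MeasurableSpace Ω› :=
  (measurable_pi_lambda _ h.measurable_N).comap_le

lemma memLp_massVector [IsProbabilityMeasure P] (h : IsDDP c₀ c nb F₀ G N F P)
    (hB : IsMeasurablePartition B) (t : T) (k : Fin K) :
    MemLp (fun ω => massVector B (F t ω) k) 2 P := by
  refine MemLp.of_bound ((measurable_pi_apply k).comp
    ((measurable_massVector hB).comp (h.measurable_F t))).aestronglyMeasurable 1 ?_
  filter_upwards [h.isProbabilityMeasure_F t] with ω hω
  rw [massVector, Real.norm_of_nonneg measureReal_nonneg]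
  exact measureReal_le_one

variable [IsProbabilityMeasure F₀]

lemma mixedCounts (h : IsDDP c₀ c nb F₀ G N F P) (hc₀ : 0 < c₀) (hB : IsMeasurablePartition B) :
    MixedCounts (MeasurableSpace.comap G inferInstance) (fun k => c₀ * F₀.real (B k)) c
      (fun ω => massVector B (G ω)) (fun t ω => massVector B (N t ω)) P where
  le := h.level_one.measurable.comap_le
  nonneg k := mul_nonneg hc₀.le measureReal_nonneg
  sum_pos := by rwa [sum_prior hB]
  hasLaw := h.level_one.hasLaw K B hB
  measurable t := (measurable_massVector hB).comp (h.measurable_N t)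
  condIndep := h.condIndep_N.map (measurable_massVector hB)
  condLaw t := h.level_two t K B hB

/-- The conditional law of the masses of `F t`, with the posterior parameters written out. -/
lemma hasCondLaw_massVector (h : IsDDP c₀ c nb F₀ G N F P) (hc₀ : 0 < c₀)
    (hB : IsMeasurablePartition B) (t : T) :
    HasCondLaw (MeasurableSpace.comap (fun ω t => N t ω) inferInstance)
      (fun ω => massVector B (F t ω))
      (fun ω => dirichletMeasure fun k =>
        c₀ * F₀.real (B k) + ∑ j ∈ nb t, massVector B (N j ω) k) P := by
  refine (h.level_three t K B hB).congr ?_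
  filter_upwards [ae_all_iff.2 h.isFiniteMeasure_N] with ω hω
  congr 1
  ext k
  have hp := updatedPrecision_pos (c := c) hc₀ (nb t)
  simp only [updatedCentre, massVector]
  have hne : (ENNReal.ofReal c₀ • F₀) (B k) ≠ ∞ :=
    ENNReal.mul_ne_top ENNReal.ofReal_ne_top (measure_ne_top _ _)
  have hsum : (∑ j ∈ nb t, N j ω).real (B k) = ∑ j ∈ nb t, (N j ω).real (B k) := by
    rw [measureReal_def, Measure.finsetSum_apply, ENNReal.toReal_sum fun j _ => measure_ne_top _ _]
    rfl
  rw [measureReal_ennreal_smul_apply, measureReal_add_apply hne, measureReal_ennreal_smul_apply,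
    hsum, ENNReal.toReal_inv, ENNReal.toReal_ofReal hp.le,
    ENNReal.toReal_ofReal hc₀.le, mul_inv_cancel_left₀ hp.ne']

variable [IsProbabilityMeasure P]

/-- On a fixed partition, the marginal law of `F t` is that of the prior. -/
lemma hasLaw_massVector (h : IsDDP c₀ c nb F₀ G N F P) (hc₀ : 0 < c₀)
    (hB : IsMeasurablePartition B) (t : T) :
    HasLaw (fun ω => massVector B (F t ω)) (dirichletMeasure fun k => c₀ * F₀.real (B k)) P := by
  classical
  have hW : Measurable fun ω => massVector B (F t ω) :=
    (measurable_massVector hB).comp (h.measurable_F t)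
  -- Only the counts in the neighbourhood of `t` enter the law of `F t`.
  have hC := (h.mixedCounts hc₀ hB).comp_injective (e := fun j : nb t => (j : T))
    Subtype.val_injective
  refine ⟨hW.aemeasurable, ?_⟩
  have := Measure.isProbabilityMeasure_map (μ := P) hW.aemeasurable
  ext A hA
  rw [← measureReal_eq_measureReal_iff]
  set W := fun ω => massVector B (F t ω)
  rw [map_measureReal_apply hW hA,
    ← sum_integral_mul_dirichletMeasure_real (c := fun j : nb t => c j) hC.nonneg hC.sum_pos hA,
    ← integral_indicator_one (hW hA), sum_integral_countEvent hC.measurable hC.ae_exists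
      (f := (W ⁻¹' A).indicator 1) ((integrable_const 1).indicator (hW hA))]
  refine Finset.sum_congr rfl fun x _ => ?_
  have hS : MeasurableSet[MeasurableSpace.comap (fun ω t => N t ω) inferInstance]
      (countEvent (fun (j : nb t) ω => massVector B (N j ω)) x) :=
    measurableSet_countEvent (U := fun (j : nb t) ω => massVector B (N j ω))
      (fun j => measurable_massVector_comap hB (j : T)) x
  have h1 := (h.hasCondLaw_massVector hc₀ hB t).measureReal_inter h.comap_le hW hS hA
  rw [← hC.measureReal_countEvent, setIntegral_indicator (hW hA)]
  simp only [Pi.one_apply, setIntegral_const, smul_eq_mul, mul_one]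
  rw [h1, setIntegral_congr_fun (h.comap_le _ hS)
    (g := fun _ => (dirichletMeasure fun k => c₀ * F₀.real (B k) + ∑ j, (x j k : ℝ)).real A),
    setIntegral_const, smul_eq_mul]
  intro ω hω
  have h2 : ∀ k, ∑ j ∈ nb t, massVector B (N j ω) k = ∑ j, (x j k : ℝ) := by
    intro k
    rw [← Finset.sum_coe_sort]
    refine Finset.sum_congr rfl fun j _ => ?_
    have := congrFun (mem_countEvent.1 hω j) k
    exact this
  simp only [h2]

lemma marginal (h : IsDDP c₀ c nb F₀ G N F P) (hc₀ : 0 < c₀) (t : T) :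
    IsDirichletProcess c₀ F₀ (F t) P where
  measurable := h.measurable_F t
  isProbabilityMeasure := h.isProbabilityMeasure_F t
  hasLaw _ _ hB := h.hasLaw_massVector hc₀ hB t

/-- Given the counts, `F t` and `F t'` are independent, so that the mean of a product of masses is
the mean of the product of the posterior means. -/
lemma integral_massVector_mul (h : IsDDP c₀ c nb F₀ G N F P) (hc₀ : 0 < c₀)
    (hB : IsMeasurablePartition B) {t t' : T} (htt' : t ≠ t') (k l : Fin K)
    (hint : Integrable (fun ω => massVector B (F t ω) k * massVector B (F t' ω) l) P) :
    ∫ ω, massVector B (F t ω) k * massVector B (F t' ω) l ∂P =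
      ∫ ω, (c₀ * F₀.real (B k) + ∑ j ∈ nb t, massVector B (N j ω) k) /
          updatedPrecision c₀ c (nb t) *
        ((c₀ * F₀.real (B l) + ∑ j ∈ nb t', massVector B (N j ω) l) /
          updatedPrecision c₀ c (nb t')) ∂P := by
  classical
  have hC := h.mixedCounts hc₀ hB
  rw [sum_integral_countEvent hC.measurable hC.ae_exists hint,
    integral_eq_sum_counts hC.measurable hC.ae_exists (φ := fun x =>
      (c₀ * F₀.real (B k) + ∑ j ∈ nb t, (x j k : ℝ)) / updatedPrecision c₀ c (nb t) *
      ((c₀ * F₀.real (B l) + ∑ j ∈ nb t', (x j l : ℝ)) / updatedPrecision c₀ c (nb t')))]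
  · refine Finset.sum_congr rfl fun x hx => ?_
    have hS : MeasurableSet[MeasurableSpace.comap (fun ω t => N t ω) inferInstance]
        (countEvent (fun (j : T) ω => massVector B (N j ω)) x) :=
      measurableSet_countEvent (fun j => measurable_massVector_comap hB j) x
    have hν : ∀ s, ∀ ω ∈ countEvent (fun (j : T) ω => massVector B (N j ω)) x,
        (dirichletMeasure fun k => c₀ * F₀.real (B k) + ∑ j ∈ nb s, massVector B (N j ω) k) =
          dirichletMeasure fun k => c₀ * F₀.real (B k) + ∑ j ∈ nb s, (x j k : ℝ) := by
      intro s ω hω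
      simp only [mem_countEvent.1 hω, castVec]
    have hsum : ∀ s, ∑ k, (c₀ * F₀.real (B k) + ∑ j ∈ nb s, (x j k : ℝ)) =
        updatedPrecision c₀ c (nb s) := by
      intro s
      rw [Finset.sum_add_distrib, sum_prior hB, updatedPrecision, Finset.sum_comm]
      congr 1
      refine Finset.sum_congr rfl fun j _ => ?_
      rw [← Nat.cast_sum, (Finset.mem_piAntidiag.1 (Fintype.mem_piFinset.1 hx j)).1]
    have hmean : ∀ s k, ∫ v, v k ∂(dirichletMeasure fun k => c₀ * F₀.real (B k) +
        ∑ j ∈ nb s, (x j k : ℝ)) = (c₀ * F₀.real (B k) + ∑ j ∈ nb s, (x j k : ℝ)) /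
          updatedPrecision c₀ c (nb s) := by
      intro s k
      rw [integral_coord_dirichletMeasure, hsum]
      · intro k
        exact add_nonneg (hC.nonneg k) (Finset.sum_nonneg fun _ _ => Nat.cast_nonneg _)
      · rw [hsum]
        exact updatedPrecision_pos hc₀ _
    have h1 := (h.condIndep_F.map (measurable_massVector hB)).setIntegral_mul h.comap_le
      (fun s => (measurable_massVector hB).comp (h.measurable_F s))
      (fun s => h.hasCondLaw_massVector hc₀ hB s) hS hν htt' (measurable_pi_apply k)
      (measurable_pi_apply l)
    rw [h1, hmean, hmean]
  · intro x ω hω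
    simp only [mem_countEvent.1 hω, castVec]

lemma integral_massVector (h : IsDDP c₀ c nb F₀ G N F P) (hc₀ : 0 < c₀)
    (hB : IsMeasurablePartition B) (t : T) (k : Fin K) :
    ∫ ω, massVector B (F t ω) k ∂P = F₀.real (B k) := by
  have hl := h.hasLaw_massVector hc₀ hB t
  have hC := h.mixedCounts hc₀ hB
  have h1 := integral_coord_dirichletMeasure hC.nonneg hC.sum_pos k
  rw [← hl.map_eq, integral_map hl.aemeasurable
    (measurable_pi_apply k).aestronglyMeasurable] at h1
  rw [h1, sum_prior hB, mul_div_cancel_left₀ _ hc₀.ne']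

lemma variance_massVector (h : IsDDP c₀ c nb F₀ G N F P) (hc₀ : 0 < c₀)
    (hB : IsMeasurablePartition B) (t : T) (k : Fin K) :
    Var[fun ω => massVector B (F t ω) k; P] =
      F₀.real (B k) * (1 - F₀.real (B k)) / (c₀ + 1) := by
  have hl := h.hasLaw_massVector hc₀ hB t
  have hC := h.mixedCounts hc₀ hB
  have h1 := integral_coord_mul_coord_dirichletMeasure hC.nonneg hC.sum_pos k k
  have hm : Measurable fun p : Fin K → ℝ => p k * p k := by fun_prop
  rw [← hl.map_eq, integral_map hl.aemeasurable hm.aestronglyMeasurable] at h1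
  have h2 := h.memLp_massVector hB t k
  have hc1 : c₀ + 1 ≠ 0 := by positivity
  rw [← covariance_self h2.aestronglyMeasurable.aemeasurable, covariance_eq_sub h2 h2,
    h.integral_massVector hc₀ hB]
  simp only [Pi.mul_apply]
  rw [h1, sum_prior hB]
  simp only [if_true]
  field_simp
  ring

/-- The covariance of the masses which two distinct random measures of the third level give to
cells of a partition. -/
lemma covariance_massVector [DecidableEq T] (h : IsDDP c₀ c nb F₀ G N F P) (hc₀ : 0 < c₀)
    (hB : IsMeasurablePartition B) {t t' : T} (htt' : t ≠ t') (k l : Fin K) :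
    cov[fun ω => massVector B (F t ω) k, fun ω => massVector B (F t' ω) l; P] =
      (c₀ * (∑ j ∈ nb t ∩ nb t', (c j : ℝ)) +
          (∑ j ∈ nb t, (c j : ℝ)) * (∑ j ∈ nb t', (c j : ℝ))) /
        ((c₀ + ∑ j ∈ nb t, (c j : ℝ)) * (c₀ + ∑ j ∈ nb t', (c j : ℝ))) *
      (((if k = l then F₀.real (B k) else 0) - F₀.real (B k) * F₀.real (B l)) / (c₀ + 1)) := by
  have hC := h.mixedCounts hc₀ hB
  have hM : ∀ s k, MemLp (fun ω => ∑ j ∈ nb s, massVector B (N j ω) k) 2 P :=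
    fun s k => memLp_finsetSum (nb s) fun j _ => hC.memLp_count j k
  have hM2 : ∀ s k, MemLp (fun ω => (c₀ * F₀.real (B k) + ∑ j ∈ nb s, massVector B (N j ω) k) /
      updatedPrecision c₀ c (nb s)) 2 P := by
    intro s k
    have h1 : MemLp (fun ω => c₀ * F₀.real (B k) + ∑ j ∈ nb s, massVector B (N j ω) k) 2 P :=
      (memLp_const (c₀ * F₀.real (B k))).add (hM s k)
    simpa only [div_eq_inv_mul] using h1.const_mul (updatedPrecision c₀ c (nb s))⁻¹
  have hmean : ∀ s k, ∫ ω, (c₀ * F₀.real (B k) + ∑ j ∈ nb s, massVector B (N j ω) k) /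
      updatedPrecision c₀ c (nb s) ∂P = F₀.real (B k) := by
    intro s k
    rw [integral_div, integral_add (integrable_const _) ((hM s k).integrable one_le_two),
      integral_finsetSum _ fun j _ => (hC.memLp_count j k).integrable one_le_two]
    simp only [hC.integral_count, sum_prior hB, mul_div_cancel_left₀ _ hc₀.ne', ← Finset.sum_mul]
    have := updatedPrecision_pos (c := c) hc₀ (nb s)
    simp only [integral_const, probReal_univ, one_smul]
    rw [← add_mul]
    exact mul_div_cancel_left₀ _ this.ne'
  have h1 := h.memLp_massVector hB t k
  have h2 := h.memLp_massVector hB t' l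
  have hcov : cov[fun ω => massVector B (F t ω) k, fun ω => massVector B (F t' ω) l; P] =
      cov[fun ω => (c₀ * F₀.real (B k) + ∑ j ∈ nb t, massVector B (N j ω) k) /
          updatedPrecision c₀ c (nb t),
        fun ω => (c₀ * F₀.real (B l) + ∑ j ∈ nb t', massVector B (N j ω) l) /
          updatedPrecision c₀ c (nb t'); P] := by
    rw [covariance_eq_sub h1 h2, covariance_eq_sub (hM2 t k) (hM2 t' l), hmean, hmean,
      h.integral_massVector hc₀ hB, h.integral_massVector hc₀ hB]
    congr 1
    exact h.integral_massVector_mul hc₀ hB htt' k l (h1.integrable_mul h2)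
  rw [hcov, covariance_fun_div_left, covariance_fun_div_right,
    covariance_const_add_left ((hM t k).integrable one_le_two),
    covariance_const_add_right ((hM t' l).integrable one_le_two), hC.covariance_sum_count,
    dirichletCov_prior hc₀ hB, sum_prior hB, updatedPrecision, updatedPrecision]
  have := (updatedPrecision_pos (c := c) hc₀ (nb t)).ne'
  have := (updatedPrecision_pos (c := c) hc₀ (nb t')).ne'
  rw [updatedPrecision] at *
  field_simp
  ring

end IsDDP

/-! ### Independence without counts -/

/-- Finitely many measurable sets are unions of cells of a common finite measurable partition. -/
lemma exists_isMeasurablePartition {X : Type*} [MeasurableSpace X]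
    (S : Finset {s : Set X // MeasurableSet s}) :
    ∃ (K : ℕ) (B : Fin K → Set X), IsMeasurablePartition B ∧
      ∀ s ∈ S, ∃ I : Finset (Fin K), (s : Set X) = ⋃ k ∈ I, B k := by
  classical
  -- The cells are the fibres of the map recording which of the sets contain a point.
  let σ : X → S → Bool := fun x s => decide (x ∈ (s : {s : Set X // MeasurableSet s}).1)
  let e := Fintype.equivFin (S → Bool)
  have hσ : Measurable σ := measurable_pi_lambda _ fun s =>
    measurable_to_bool (by
      convert s.1.2 using 1
      ext x
      simp [σ])
  refine ⟨_, fun k => σ ⁻¹' {e.symm k}, ⟨fun k => hσ (measurableSet_singleton _), ?_, ?_⟩, ?_⟩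
  · intro i j hij
    refine Set.disjoint_left.2 fun x h1 h2 => hij ?_
    exact e.symm.injective (h1.symm.trans h2)
  · refine Set.eq_univ_of_forall fun x => Set.mem_iUnion.2 ⟨e (σ x), ?_⟩
    simp
  · intro s hs
    refine ⟨Finset.univ.filter fun k => e.symm k ⟨s, hs⟩ = true, ?_⟩
    ext x
    simp only [Set.mem_iUnion, Finset.mem_filter, Finset.mem_univ, true_and, Set.mem_preimage,
      Set.mem_singleton_iff, exists_prop]
    refine ⟨fun hx => ⟨e (σ x), ?_, ?_⟩, ?_⟩
    · simpa [σ] using hx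
    · simp
    · rintro ⟨k, hk, hxk⟩
      rw [← hxk] at hk
      simpa [σ] using hk

namespace IsDDP

variable {Ω X T : Type*} [MeasurableSpace Ω] [MeasurableSpace X] [Fintype T]
  {P : Measure Ω} [IsProbabilityMeasure P] {F₀ : Measure X} [IsProbabilityMeasure F₀]
  {c₀ : ℝ} {c : T → ℕ} {nb : T → Finset T} {G : Ω → Measure X} {N F : T → Ω → Measure X}
  {K : ℕ} {B : Fin K → Set X}

/-- Without counts the conditional laws of the `F t` are deterministic, so that the `F t` are
independent on every partition. -/
lemma iIndepFun_massVector (h : IsDDP c₀ c nb F₀ G N F P) (hc₀ : 0 < c₀) (hc : ∀ t, c t = 0)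
    (hB : IsMeasurablePartition B) : iIndepFun (fun t ω => massVector B (F t ω)) P := by
  have hW : ∀ t, Measurable fun ω => massVector B (F t ω) :=
    fun t => (measurable_massVector hB).comp (h.measurable_F t)
  have hN : ∀ᵐ ω ∂P, ∀ j k, massVector B (N j ω) k = 0 := by
    filter_upwards [ae_all_iff.2 (h.mixedCounts hc₀ hB).ae_exists] with ω hω j k
    obtain ⟨x, hx, hxω⟩ := hω j
    rw [hc j, Finset.piAntidiag_zero, Finset.mem_singleton] at hx
    rw [hxω, hx]
    simp [castVec]
  have hlaw : ∀ t, HasCondLaw (MeasurableSpace.comap (fun ω t => N t ω) inferInstance)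
      (fun ω => massVector B (F t ω))
      (fun _ => dirichletMeasure fun k => c₀ * F₀.real (B k)) P := by
    intro t
    refine (h.hasCondLaw_massVector hc₀ hB t).congr ?_
    filter_upwards [hN] with ω hω
    simp [hω]
  rw [iIndepFun_iff_map_fun_eq_pi_map fun t => (hW t).aemeasurable]
  simp only [(h.hasLaw_massVector hc₀ hB _).map_eq]
  refine (Measure.pi_eq fun A hA => ?_).symm
  rw [Measure.map_apply (measurable_pi_lambda _ hW) (MeasurableSet.univ_pi hA)]
  have h1 := (h.condIndep_F.map (measurable_massVector hB)).measureReal_inter_iInter h.comap_le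
    hW hlaw MeasurableSet.univ hA
  have h2 : (fun ω t => massVector B (F t ω)) ⁻¹' Set.univ.pi A =
      ⋂ t, (fun ω => massVector B (F t ω)) ⁻¹' A t := by
    ext ω
    simp
  rw [Set.univ_inter, setIntegral_univ, integral_const, probReal_univ, one_smul] at h1
  rw [h2, ← ofReal_measureReal, h1, ENNReal.ofReal_prod_of_nonneg fun _ _ => measureReal_nonneg]
  exact Finset.prod_congr rfl fun t _ => ofReal_measureReal

lemma iIndepFun_of_forall_eq_zero (h : IsDDP c₀ c nb F₀ G N F P) (hc₀ : 0 < c₀)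
    (hc : ∀ t, c t = 0) : iIndepFun F P := by
  classical
  have hproc : iIndepFun
      (fun t ω (s : {s : Set X // MeasurableSet s}) => F t ω s) P := by
    refine iIndepFun.iIndepFun_process
      (fun t s => (Measure.measurable_coe s.2).comp (h.measurable_F t)) fun I J => ?_
    obtain ⟨K, B, hB, hS⟩ := exists_isMeasurablePartition (Finset.univ.biUnion J)
    choose! S hS using hS
    have h1 := ((h.iIndepFun_massVector hc₀ hc hB).precomp
      (Subtype.val_injective (p := fun t => t ∈ I))).comp
      (fun i p (s : J i) => ∑ k ∈ S s, ENNReal.ofReal (p k)) fun i => by fun_prop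
    refine h1.congr fun i => ?_
    filter_upwards [h.isProbabilityMeasure_F i] with ω hω
    ext s
    have hs := hS s (Finset.mem_biUnion.2 ⟨i, Finset.mem_univ i, s.2⟩)
    rw [hs, measure_biUnion_finset (fun a _ b _ hab => hB.disjoint hab)
      fun k _ => hB.measurableSet k]
    exact Finset.sum_congr rfl fun k _ => ofReal_measureReal
  -- The σ-algebra on measures is generated by the evaluations, so `F t` and the process of its
  -- values generate the same σ-algebra.
  have hle : ∀ t, MeasurableSpace.comap (F t) inferInstance ≤ MeasurableSpace.comap
      (fun ω (s : {s : Set X // MeasurableSet s}) => F t ω s) inferInstance := by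
    intro t
    refine Measurable.comap_le (Measure.measurable_of_measurable_coe _ fun s hs => ?_)
    exact (measurable_pi_apply (⟨s, hs⟩ : {s : Set X // MeasurableSet s})).comp
      (comap_measurable fun ω (s : {s : Set X // MeasurableSet s}) => F t ω s)
  rw [iIndepFun_iff] at hproc ⊢
  exact fun S A hA => hproc S fun i hi => hle i _ (hA i hi)

end IsDDP

end LatentDDP

theorem proposition1 {Ω X T : Type*} [MeasurableSpace Ω] [MeasurableSpace X]
    [Fintype T] [DecidableEq T]
    (P : Measure Ω) [IsProbabilityMeasure P]
    (F₀ : Measure X) [IsProbabilityMeasure F₀]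
    (c₀ : ℝ) (hc₀ : 0 < c₀) (c : T → ℕ) (nb : T → Finset T)
    (G : Ω → Measure X) (N F : T → Ω → Measure X)
    (h : LatentDDP.IsDDP c₀ c nb F₀ G N F P) :
    -- (i) every `F t` is marginally a Dirichlet process `DP(c₀, F₀)`
    (∀ t, LatentDDP.IsDirichletProcess c₀ F₀ (F t) P) ∧
    -- (ii) the correlations are well defined
    (∀ (t : T) (B : Set X), MeasurableSet B → 0 < F₀.real B → F₀.real B < 1 →
      MemLp (fun ω => (F t ω).real B) 2 P ∧ 0 < Var[fun ω => (F t ω).real B; P]) ∧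
    -- (ii) correlation on a single set
    (∀ (t t' : T), t ≠ t' → ∀ B : Set X, MeasurableSet B → 0 < F₀.real B → F₀.real B < 1 →
      LatentDDP.corr (fun ω => (F t ω).real B) (fun ω => (F t' ω).real B) P =
        (c₀ * (∑ j ∈ nb t ∩ nb t', (c j : ℝ)) +
            (∑ j ∈ nb t, (c j : ℝ)) * (∑ j ∈ nb t', (c j : ℝ))) /
          ((c₀ + ∑ j ∈ nb t, (c j : ℝ)) * (c₀ + ∑ j ∈ nb t', (c j : ℝ)))) ∧
    -- (ii) cross-correlation on two disjoint sets
    (∀ (t t' : T), t ≠ t' → ∀ B₁ B₂ : Set X, MeasurableSet B₁ → MeasurableSet B₂ →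
      Disjoint B₁ B₂ → 0 < F₀.real B₁ → F₀.real B₁ < 1 → 0 < F₀.real B₂ → F₀.real B₂ < 1 →
      LatentDDP.corr (fun ω => (F t ω).real B₁) (fun ω => (F t' ω).real B₂) P =
        -√(F₀.real B₁ * F₀.real B₂ / ((1 - F₀.real B₁) * (1 - F₀.real B₂))) *
          LatentDDP.corr (fun ω => (F t ω).real B₁) (fun ω => (F t' ω).real B₁) P) ∧
    -- (iii) independence when all the `c t` vanish
    ((∀ t, c t = 0) → iIndepFun F P) := by
  have hc1 : 0 < c₀ + 1 := by positivity
  have hvar : ∀ (t : T) (B : Set X), MeasurableSet B →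
      Var[fun ω => (F t ω).real B; P] = F₀.real B * (1 - F₀.real B) / (c₀ + 1) :=
    fun t B hB => h.variance_massVector hc₀ (LatentDDP.isMeasurablePartition_compl hB) t 0
  have hcorr : ∀ (t t' : T), t ≠ t' → ∀ B : Set X, MeasurableSet B → 0 < F₀.real B →
      F₀.real B < 1 → LatentDDP.corr (fun ω => (F t ω).real B) (fun ω => (F t' ω).real B) P =
        (c₀ * (∑ j ∈ nb t ∩ nb t', (c j : ℝ)) +
            (∑ j ∈ nb t, (c j : ℝ)) * (∑ j ∈ nb t', (c j : ℝ))) /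
          ((c₀ + ∑ j ∈ nb t, (c j : ℝ)) * (c₀ + ∑ j ∈ nb t', (c j : ℝ))) := by
    intro t t' htt' B hB h0 h1
    have hcov := h.covariance_massVector hc₀ (LatentDDP.isMeasurablePartition_compl hB) htt' 0 0
    have hv : 0 < F₀.real B * (1 - F₀.real B) / (c₀ + 1) :=
      div_pos (mul_pos h0 (sub_pos.2 h1)) hc1
    simp only [LatentDDP.massVector, Matrix.cons_val_zero, if_true] at hcov
    rw [LatentDDP.corr, hvar t B hB, hvar t' B hB, Real.mul_self_sqrt hv.le, hcov,
      show F₀.real B - F₀.real B * F₀.real B = F₀.real B * (1 - F₀.real B) by ring,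
      mul_div_cancel_right₀ _ hv.ne']
  refine ⟨fun t => h.marginal hc₀ t, fun t B hB h0 h1 => ⟨?_, ?_⟩, hcorr, ?_,
    h.iIndepFun_of_forall_eq_zero hc₀⟩
  · exact h.memLp_massVector (LatentDDP.isMeasurablePartition_compl hB) t 0
  · rw [hvar t B hB]
    exact div_pos (mul_pos h0 (sub_pos.2 h1)) hc1
  · intro t t' htt' B₁ B₂ hB₁ hB₂ hd h1 h1' h2 h2'
    have hcov := h.covariance_massVector hc₀
      (LatentDDP.isMeasurablePartition_of_disjoint hB₁ hB₂ hd) htt' 0 1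
    simp only [LatentDDP.massVector, Matrix.cons_val_zero, Matrix.cons_val_one, zero_ne_one,
      if_false] at hcov
    rw [hcorr t t' htt' B₁ hB₁ h1 h1', LatentDDP.corr, hvar t B₁ hB₁, hvar t' B₂ hB₂, hcov]
    set ρ := (c₀ * (∑ j ∈ nb t ∩ nb t', (c j : ℝ)) +
            (∑ j ∈ nb t, (c j : ℝ)) * (∑ j ∈ nb t', (c j : ℝ))) /
          ((c₀ + ∑ j ∈ nb t, (c j : ℝ)) * (c₀ + ∑ j ∈ nb t', (c j : ℝ)))
    have hg1 : 0 < 1 - F₀.real B₁ := sub_pos.2 h1'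
    have hg2 : 0 < 1 - F₀.real B₂ := sub_pos.2 h2'
    set f₁ := F₀.real B₁
    set f₂ := F₀.real B₂
    -- Write every square root in terms of the roots of `f₁`, `f₂`, `1 - f₁`, `1 - f₂`, `c₀ + 1`.
    rw [Real.sqrt_div (by positivity), Real.sqrt_div (by positivity), Real.sqrt_div (by positivity),
      Real.sqrt_mul h1.le, Real.sqrt_mul h2.le, Real.sqrt_mul h1.le, Real.sqrt_mul hg1.le]
    have e1 := Real.sq_sqrt h1.le
    have e2 := Real.sq_sqrt h2.le
    have e3 := Real.sq_sqrt hc1.le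
    have p1 := Real.sqrt_pos.2 h1
    have p2 := Real.sqrt_pos.2 h2
    have p3 := Real.sqrt_pos.2 hc1
    have p4 := Real.sqrt_pos.2 hg1
    have p5 := Real.sqrt_pos.2 hg2
    rw [zero_sub]
    nth_rw 1 [← e1, ← e2, ← e3]
    field_simp
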